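/- **Setting.** For each $n\ge 1$ let $G_n$ be a random undirected graph on $N_n=\{1,\dots,n\}$ and $\mathcal C_n$ a $\sigma$-field with respect to which the adjacency matrix of $G_n$ is measurable. Let $d_n(i,j)\in\{0,1,2,\dots\}\cup\{\infty\}$ be the graph distance ($\infty$ for disconnected nodes), and $d_n(A,B)=\min_{i\in A,\,j\in B}d_n(i,j)$ for $A,B\subset N_n$. Below, $s$ ranges over $\{0,1,2,\dots\}\cup\{\infty\}$, so that sums over $s$ include the term $s=\infty$; this term vanishes if $G_n$ is connected. Let $N_n(i;r)=\{j:d_n(i,j)\le r\}$ for real $r$, $N_n^\partial(i;s)=\{j:d_n(i,j)=s\}$, and $$\delta_n^\partial(s;k)=\frac1n\sum_{i}|N_n^\partial(i;s)|^k,\qquad \delta_n^\partial(s)=\delta_n^\partial(s;1),\qquad \delta_n(r)=\frac1n\sum_i|N_n(i;r)|,$$ $$\Delta_n(s,m;k)=\frac1n\sum_i\max_{j\in N_n^\partial(i;s)}\bigl|\{l\in N_n(i;m): d_n(j,l)\ge s\}\bigr|^k,$$ (the maximum over an empty set is $0$), and $$c_n(s,m;k)=\inf_{\alpha>1}\,[\Delta_n(s,m;k\alpha)]^{1/\alpha}\,[\delta_n^\partial(s;\tfrac{\alpha}{\alpha-1})]^{1-1/\alpha}.$$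 Let $Y_{n,i}$, $i\in N_n$, be $\mathbb R^v$-valued random vectors, $S_n=\sum_iY_{n,i}$, $\bar Y_n=S_n/n$ and $V_n=\operatorname{Var}(S_n/\sqrt n\mid\mathcal C_n)$. Conditional moments are only required to be finite almost surely; conditional expectations of variables with a.s. finite conditional first absolute moment are taken as the difference of those of the positive and negative parts. Write $\|X\|_{\mathcal C_n,p}=(E[\|X\|^p\mid\mathcal C_n])^{1/p}$. Let $\omega:\overline{\mathbb R}\to[-1,1]$ be a Borel kernel with $\omega(0)=1$, $\omega(z)=0$ for $|z|>1$ and $\omega(z)=\omega(-z)$, let $b_n$ be real $\mathcal C_n$-measurable bandwidths that are, almost surely, positive for all large $n$, and let $\omega_n(s)=\omega(s/b_n)$. Define $$\tilde V_n=\sum_{s\ge0}\omega_n(s)\frac1n\sum_i\sum_{j\in N_n^\partial(i;s)}Y_{n,i}Y_{n,j}^\top,\qquad \hat V_n=\sum_{s\ge0}\omega_n(s)\frac1n\sum_i\sum_{j\in N_n^\partial(i;s)}(Y_{n,i}-\bar Y_n)(Y_{n,j}-\bar Y_n)^\top .$$ **Dependence assumption.** There are nonnegative $\mathcal C_n$-measurable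 coefficients $\theta_{n,s}$ with $\theta_{n,0}=1$, nonrandom functionals $\psi_{a,b}\ge0$ and a constant $C>0$ such that, for all $n$, $a,b\ge1$ and $s>0$, all $A,B\subset N_n$ with $|A|=a$, $|B|=b$, and all bounded Lipschitz $f:\mathbb R^{v\times a}\to\mathbb R$, $g:\mathbb R^{v\times b}\to\mathbb R$, $$|\operatorname{Cov}(f(Y_{n,A}),g(Y_{n,B})\mid\mathcal C_n)|\le\psi_{a,b}(f,g)\,\theta_{n,s}\quad\text{a.s. on }\{d_n(A,B)\ge s\},$$ where $Y_{n,A}=(Y_{n,i})_{i\in A}$, $$\psi_{a,b}(f,g)\le C\,ab\,(\|f\|_\infty+\operatorname{Lip}(f))(\|g\|_\infty+\operatorname{Lip}(g)),$$ and $\sup_{n}\sup_{s\ge1}\theta_{n,s}<\infty$ a.s. Here $\operatorname{Lip}$ is the smallest Lipschitz constant for the distance $\sum_l\|x_l-y_l\|$. **Moment, kernel and bandwidth assumption.** For some $p>4$: (i) $\sup_n\max_{i\in N_n}\|Y_{n,i}\|_{\mathcal C_n,p}<\infty$ a.s.; (ii) $\sum_{s\ge1}|\omega_n(s)-1|\,\delta_n^\partial(s)\,\theta_{n,s}^{1-2/p}\to0$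 a.s.; (iii) $n^{-1}\sum_{s\ge0}c_n(s,b_n;2)\,\theta_{n,s}^{1-4/p}\to0$ a.s. **Proposition.** (a) If $E[Y_{n,i}\mid\mathcal C_n]=0$ a.s. for all $n$ and $i\in N_n$, then $E[\|\tilde V_n-V_n\|_F\mid\mathcal C_n]\to0$ a.s., where $\|\cdot\|_F$ is the Frobenius norm. (b) If instead $E[Y_{n,i}\mid\mathcal C_n]=\Lambda_n$ a.s. for all $n$ and $i\in N_n$, for some $\Lambda_n$ not depending on $i$, and if in addition $\delta_n(b_n)=o(n)$ a.s. and, a.s. for every $n$, $\theta_{n,s}/s^{p/(p-4)}$ is non-increasing in the integers $s\ge1$, then $E[\|\hat V_n-V_n\|_F\mid\mathcal C_n]\to0$ a.s. -/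

import Mathlib

open MeasureTheory Filter Topology
open scoped ENNReal

namespace NetworkHAC

noncomputable section

/-! ### Conditional expectations

Conditional moments are only assumed to be finite almost surely, so the underlying variables need
not be integrable. The conditional expectation of a real variable is therefore the difference of the
`[0,∞]`-valued conditional expectations of its positive and negative parts. -/

/-- Conditional expectation `E[X | m]` of a real random variable whose conditional first absolute
moment is almost surely finite (`X` itself need not be integrable). -/
def condE {Ω : Type*} (m : MeasurableSpace Ω) {mΩ : MeasurableSpace Ω} (μ : Measure Ω)
    (X : Ω → ℝ) (ω : Ω) : ℝ :=
  (condLExp m μ (fun ω' => ENNReal.ofReal (X ω')) ω).toReal -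
    (condLExp m μ (fun ω' => ENNReal.ofReal (-X ω')) ω).toReal

/-- On integrable variables `condE` is the usual conditional expectation. -/
theorem condE_ae_eq_condExp {Ω : Type*} (m : MeasurableSpace Ω) {mΩ : MeasurableSpace Ω}
    (μ : Measure Ω) (X : Ω → ℝ) (hX : Integrable X μ) :
    condE m μ X =ᵐ[μ] μ[X|m] := by
  have key : ∀ Z : Ω → ℝ, Integrable Z μ →
      (fun ω => (condLExp m μ (fun ω' => ENNReal.ofReal (Z ω')) ω).toReal)
        =ᵐ[μ] μ[fun ω => max (Z ω) 0|m] := by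
    intro Z hZ
    have h := toReal_condLExp m (μ := μ) (f := fun ω' => ENNReal.ofReal (Z ω'))
      hZ.aemeasurable.ennreal_ofReal hZ.lintegral_lt_top.ne
    simpa [ENNReal.toReal_ofReal'] using h
  have h3 := condExp_sub (m := m) (μ := μ) hX.pos_part hX.neg.pos_part
  have h4 : ((fun ω => max (X ω) 0) - fun ω => max ((-X) ω) 0) = X := by
    funext ω
    simp
  rw [h4] at h3
  filter_upwards [key X hX, key (-X) hX.neg, h3] with ω h1 h2 h3
  rw [h3, Pi.sub_apply, ← h1, ← h2]
  rfl

/-- Conditional covariance `Cov(X, Z | m)`. -/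
def condCov {Ω : Type*} (m : MeasurableSpace Ω) {mΩ : MeasurableSpace Ω} (μ : Measure Ω)
    (X Z : Ω → ℝ) : Ω → ℝ :=
  condE m μ fun ω => (X ω - condE m μ X ω) * (Z ω - condE m μ Z ω)

/-- Conditional norm `‖X‖_{m,p} = (E[‖X‖^p | m])^{1/p}`, with values in `[0,∞]`. -/
def condNorm {Ω E : Type*} [NormedAddCommGroup E] (m : MeasurableSpace Ω) {mΩ : MeasurableSpace Ω}
    (μ : Measure Ω) (p : ℝ) (X : Ω → E) (ω : Ω) : ℝ≥0∞ :=
  (condLExp m μ (fun ω' => ‖X ω'‖ₑ ^ p) ω) ^ (1 / p)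

/-! ### Network statistics

The graph distance `G.edist` takes values in `ℕ∞`, with `G.edist i j = ⊤` when `i` and `j` are
disconnected. The distance index `s` ranges over `ℕ∞` throughout. -/

/-- An element of `ℕ∞` as an extended real number. -/
def toER (s : ℕ∞) : EReal := ((s : ℝ≥0∞) : EReal)

open Classical in
/-- The shell: nodes at distance exactly `s` from `i`. -/
def shell {n : ℕ} (G : SimpleGraph (Fin n)) (i : Fin n) (s : ℕ∞) : Finset (Fin n) :=
  {j | G.edist i j = s}

open Classical in
/-- The neighborhood: nodes within distance `r` of `i`. -/
def nbhd {n : ℕ} (G : SimpleGraph (Fin n)) (i : Fin n) (r : ℝ) : Finset (Fin n) :=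
  {j | toER (G.edist i j) ≤ (r : EReal)}

open Classical in
/-- Nodes at distance less than `s` from `i`: for integer `s` these are the nodes within distance
`s - 1`, and there are none for `s = 0`. -/
def openNbhd {n : ℕ} (G : SimpleGraph (Fin n)) (i : Fin n) (s : ℕ∞) : Finset (Fin n) :=
  {j | G.edist i j < s}

/-- Distance between two sets of nodes. -/
def setDist {n : ℕ} (G : SimpleGraph (Fin n)) (A B : Finset (Fin n)) : ℕ∞ :=
  ⨅ i ∈ A, ⨅ j ∈ B, G.edist i j

/-- `δ^∂(s;k)`, the average of the `k`-th powers of the shell sizes. -/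
def shellDensity {n : ℕ} (G : SimpleGraph (Fin n)) (s : ℕ∞) (k : ℝ) : ℝ :=
  (n : ℝ)⁻¹ * ∑ i, ((shell G i s).card : ℝ) ^ k

/-- `δ(r)`, the average size of the `r`-neighborhoods. -/
def nbhdDensity {n : ℕ} (G : SimpleGraph (Fin n)) (r : ℝ) : ℝ :=
  (n : ℝ)⁻¹ * ∑ i, ((nbhd G i r).card : ℝ)

/-- `Δ(s,m;k)`; the maximum over an empty shell is `0`. -/
def Delta {n : ℕ} (G : SimpleGraph (Fin n)) (s : ℕ∞) (m k : ℝ) : ℝ :=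
  (n : ℝ)⁻¹ * ∑ i, ⨆ j : {j // j ∈ shell G i s},
    ((nbhd G i m \ openNbhd G j.1 s).card : ℝ) ^ k

/-- `c(s,m;k) = inf_{α>1} Δ(s,m;kα)^{1/α} δ^∂(s;α/(α-1))^{1-1/α}`. -/
def cStat {n : ℕ} (G : SimpleGraph (Fin n)) (s : ℕ∞) (m k : ℝ) : ℝ :=
  ⨅ α : {α : ℝ // 1 < α},
    Delta G s m (k * α.1) ^ (1 / α.1) *
      shellDensity G s (α.1 / (α.1 - 1)) ^ (1 - 1 / α.1)

/-! ### Conditional ψ-dependence -/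

/-- `f` is Lipschitz with constant `L` for the distance `∑ l, ‖x l - y l‖` on `a`-tuples of points
of Euclidean space. -/
def LipBound {v a : ℕ} (f : (Fin a → EuclideanSpace ℝ (Fin v)) → ℝ) (L : ℝ) : Prop :=
  0 ≤ L ∧ ∀ x y, |f x - f y| ≤ L * ∑ l, ‖x l - y l‖

/-- The class of bounded Lipschitz real functions of `a`-tuples of vectors. -/
def BLip (v a : ℕ) : Set ((Fin a → EuclideanSpace ℝ (Fin v)) → ℝ) :=
  {f | (∃ M, ∀ x, |f x| ≤ M) ∧ ∃ L, LipBound f L}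

/-- Sup-norm. -/
def supNorm {v a : ℕ} (f : (Fin a → EuclideanSpace ℝ (Fin v)) → ℝ) : ℝ := ⨆ x, |f x|

/-- Smallest Lipschitz constant. -/
def lipConst {v a : ℕ} (f : (Fin a → EuclideanSpace ℝ (Fin v)) → ℝ) : ℝ := sInf {L | LipBound f L}

/-- The tuple `(Y_i)_{i ∈ A}`, listed in increasing order of `i`. -/
def subTuple {E : Type*} {n a : ℕ} (y : Fin n → E) (A : Finset (Fin n)) (hA : A.card = a) :
    Fin a → E :=
  fun l => y (A.orderEmbOfFin hA l)

/-- The triangular array `Y` is conditionally ψ-dependent given the σ-fields `C n`, along the random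
graphs `G n`, with dependence coefficients `θ n s` and (nonrandom) functionals `ψ`. The event that
two sets of nodes are at distance at least `s` is `C n`-measurable, and the covariance inequality
holds almost surely on it. For `s = ⊤` it concerns sets that no path connects. -/
structure IsPsiDependent {Ω : Type*} {mΩ : MeasurableSpace Ω} (μ : Measure Ω) {v : ℕ}
    (C : ℕ → MeasurableSpace Ω) (G : (n : ℕ) → Ω → SimpleGraph (Fin n))
    (Y : (n : ℕ) → Fin n → Ω → EuclideanSpace ℝ (Fin v))
    (θ : ℕ → ℕ∞ → Ω → ℝ) (ψ : ℕ → (a b : ℕ) → BLip v a → BLip v b → ℝ) : Prop where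
  measurable_coeff : ∀ n s, Measurable[C n] (θ n s)
  coeff_nonneg : ∀ n s ω, 0 ≤ θ n s ω
  coeff_zero : ∀ n ω, θ n 0 ω = 1
  psi_nonneg : ∀ n a b f g, 0 ≤ ψ n a b f g
  cov_le : ∀ (n a b : ℕ), 1 ≤ a → 1 ≤ b → ∀ (s : ℕ∞), 0 < s →
    ∀ (A B : Finset (Fin n)) (hA : A.card = a) (hB : B.card = b) (f : BLip v a) (g : BLip v b),
    ∀ᵐ ω ∂μ, s ≤ setDist (G n ω) A B →
      |condCov (C n) μ (fun ω' => f.1 (subTuple (fun i => Y n i ω') A hA))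
          (fun ω' => g.1 (subTuple (fun i => Y n i ω') B hB)) ω| ≤ ψ n a b f g * θ n s ω

/-! ### HAC estimators -/

/-- A kernel: an even function on the extended reals with values in `[-1,1]`, equal to `1` at `0`
and vanishing outside `[-1,1]`. -/
structure IsKernel (κ : EReal → ℝ) : Prop where
  measurable : Measurable κ
  mem_Icc : ∀ z, κ z ∈ Set.Icc (-1 : ℝ) 1
  at_zero : κ 0 = 1
  eq_zero : ∀ z : EReal, 1 < z.abs → κ z = 0
  even : ∀ z, κ (-z) = κ z

/-- The weight `κ(s / b)`. -/
def weight (κ : EReal → ℝ) (b : ℝ) (s : ℕ∞) : ℝ := κ (toER s / (b : EReal))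

/-- Frobenius norm. -/
def frob {v : ℕ} (A : Matrix (Fin v) (Fin v) ℝ) : ℝ := √(A.transpose * A).trace

/-- `n⁻¹ ∑_i ∑_{j ∈ shell i s} y_i y_jᵀ`. -/
def sampleOmega {n v : ℕ} (G : SimpleGraph (Fin n)) (y : Fin n → EuclideanSpace ℝ (Fin v))
    (s : ℕ∞) : Matrix (Fin v) (Fin v) ℝ :=
  (n : ℝ)⁻¹ • ∑ i, ∑ j ∈ shell G i s, Matrix.of fun k l => y i k * y j l

/-- The HAC estimator for known zero mean, `∑_s κ(s/b) Ω̃(s)` (a sum with finitely many nonzero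
terms). -/
def hacZeroMean {n v : ℕ} (κ : EReal → ℝ) (b : ℝ) (G : SimpleGraph (Fin n))
    (y : Fin n → EuclideanSpace ℝ (Fin v)) : Matrix (Fin v) (Fin v) ℝ :=
  ∑' s : ℕ∞, weight κ b s • sampleOmega G y s

/-- The sample mean. -/
def sampleMean {n v : ℕ} (y : Fin n → EuclideanSpace ℝ (Fin v)) : EuclideanSpace ℝ (Fin v) :=
  (n : ℝ)⁻¹ • ∑ i, y i

/-- The HAC estimator for unknown common mean: the observations are centered at the sample mean. -/
def hacDemeaned {n v : ℕ} (κ : EReal → ℝ) (b : ℝ) (G : SimpleGraph (Fin n))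
    (y : Fin n → EuclideanSpace ℝ (Fin v)) : Matrix (Fin v) (Fin v) ℝ :=
  hacZeroMean κ b G fun i => y i - sampleMean y

/-- The conditional covariance matrix `Var(S_n / √n | m)` of the normalized sum
`S_n = ∑_i Y_i`. -/
def longRunVar {Ω : Type*} (m : MeasurableSpace Ω) {mΩ : MeasurableSpace Ω} (μ : Measure Ω)
    {n v : ℕ} (Y : Fin n → Ω → EuclideanSpace ℝ (Fin v)) (ω : Ω) : Matrix (Fin v) (Fin v) ℝ :=
  Matrix.of fun k l => condCov m μ (fun ω' => ((√(n : ℝ))⁻¹ • ∑ i, Y i ω') k)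
    (fun ω' => ((√(n : ℝ))⁻¹ • ∑ i, Y i ω') l) ω

end

end NetworkHAC

namespace NetworkHAC

noncomputable section

/-! Condition first. The array at stage `n` takes values in a standard Borel space, so it has a
regular conditional law `ν n ω` given `C n` (`exists_isCondLaw`). For almost every `ω` the graph,
bandwidth and coefficients are then frozen, and conditional moments and covariances become integrals
under `ν n ω`. What remains is a non-asymptotic inequality for one law `P` (`HasTruncCov`), whose
error depends only on the moment bound and on two statistics: τ = `bandStat`, from (iii), and η =
`biasStat`, from (ii).

Covariances: ψ-dependence speaks of bounded Lipschitz functions only. Clamping at a level near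
θ^(-1/p) balances the dependence term against the tails (`IsEnvelope.abs_cov_le_of_trunc`). It gives
the rate θ^(1-2/p) for coordinates at two nodes and θ^(1-4/p) for products over two pairs of nodes.

Variance: expanding the variance of the weighted sum gives a sum over two pairs of nodes, each pair
within the bandwidth. The distance between the pairs is attained by some cross pair; the two
remaining nodes are then counted by `outerCard` (`sum_pairDist_le`), and Hölder's inequality turns
the count into `cStat` (`le_cStat`). The variance is O(τ), and the bias is O(η) by the coordinate
inequality.

Unknown mean: centering at the sample mean cancels every term containing the mean alone. The
delicate remainder is (average weight) × (centered sample mean)². Its expectation is at most a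
constant times δ(δ + η)/n, where δ is the mean neighborhood size. The `s = 0` part of (iii) already
bounds δ²/n by τ, and δ ≤ n, so this remainder is O(τ + η). -/

/-! ### Regular conditional laws. -/

open ProbabilityTheory in
theorem setLIntegral_preimage_lintegral_condDistrib {Ω β S : Type*} [MeasurableSpace Ω]
    [MeasurableSpace β] [MeasurableSpace S] [StandardBorelSpace S] [Nonempty S]
    {μ : Measure Ω} [IsFiniteMeasure μ] {X : Ω → β} {Y : Ω → S} (hX : Measurable X)
    (hY : Measurable Y) {F : β × S → ℝ≥0∞} (hF : Measurable F) {t : Set β}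
    (ht : MeasurableSet t) :
    ∫⁻ ω in X ⁻¹' t, ∫⁻ y, F (X ω, y) ∂(condDistrib Y X μ (X ω)) ∂μ
      = ∫⁻ ω in X ⁻¹' t, F (X ω, Y ω) ∂μ := by
  have hI : Measurable fun x => ∫⁻ y, F (x, y) ∂(condDistrib Y X μ x) :=
    hF.lintegral_kernel_prod_right'
  have h1 : ∫⁻ ω in X ⁻¹' t, ∫⁻ y, F (X ω, y) ∂(condDistrib Y X μ (X ω)) ∂μ
      = ∫⁻ x in t, ∫⁻ y, F (x, y) ∂(condDistrib Y X μ x) ∂(μ.map X) := by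
    rw [setLIntegral_map ht hI hX]
  have h2 := Measure.setLIntegral_compProd (μ := μ.map X) (κ := condDistrib Y X μ) hF ht
    MeasurableSet.univ
  simp only [Measure.restrict_univ] at h2
  rw [h1, ← h2, compProd_map_condDistrib hY.aemeasurable,
    setLIntegral_map (ht.prod MeasurableSet.univ) hF (hX.prodMk hY)]
  congr 2
  ext ω
  simp

/-- `ν` is a regular conditional law of `Y` given `m`. -/
structure IsCondLaw {Ω S : Type*} (m : MeasurableSpace Ω) {mΩ : MeasurableSpace Ω}
    [mS : MeasurableSpace S] (μ : Measure Ω) (Y : Ω → S) (ν : Ω → Measure S) : Prop where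
  isProbabilityMeasure : ∀ ω, IsProbabilityMeasure (ν ω)
  condLExp_ae_eq : ∀ F : Ω × S → ℝ≥0∞, Measurable[m.prod mS] F →
    condLExp m μ (fun ω => F (ω, Y ω)) =ᵐ[μ] fun ω => ∫⁻ y, F (ω, y) ∂(ν ω)

-- The law is the conditional distribution of `Y` given the identity map from `Ω` to `Ω` equipped
-- with `m`. The integrand may depend on `ω` through `m`, which is what lets random weights and
-- random centerings be frozen.
open ProbabilityTheory in
theorem exists_isCondLaw {Ω S : Type*} (m : MeasurableSpace Ω) {mΩ : MeasurableSpace Ω}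
    [mS : MeasurableSpace S] [StandardBorelSpace S] [Nonempty S] (hm : m ≤ mΩ)
    (μ : Measure Ω) [IsFiniteMeasure μ] {Y : Ω → S} (hY : Measurable Y) :
    ∃ ν : Ω → Measure S, IsCondLaw m μ Y ν := by
  refine ⟨@condDistrib Ω Ω S _ _ _ _ m Y id μ _, fun ω => inferInstance, fun F hF => ?_⟩
  refine (ae_eq_condLExp hm μ _ ?_ fun t ht => ?_).symm
  · exact @Measurable.lintegral_kernel_prod_right' Ω S m mS _ _ _ hF
  · have := @setLIntegral_preimage_lintegral_condDistrib Ω Ω S mΩ m _ _ _ μ _ id Y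
      (measurable_id'' hm) hY F hF t ht
    simpa using this

theorem measurable_condE {Ω : Type*} (m : MeasurableSpace Ω) {mΩ : MeasurableSpace Ω}
    (μ : Measure Ω) (X : Ω → ℝ) : Measurable[m] (condE m μ X) :=
  (measurable_condLExp m μ _).ennreal_toReal.sub (measurable_condLExp m μ _).ennreal_toReal

section CondLaw

variable {Ω S : Type*} {m mΩ : MeasurableSpace Ω} [mS : MeasurableSpace S] {μ : Measure Ω}
  {Y : Ω → S} {ν : Ω → Measure S}

/-- Integrability is asked at the single point `ω`, inside the almost-sure statement: moments are
finite only almost surely, so `F (ω, Y ω)` itself need not be integrable. -/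
theorem IsCondLaw.condE_eq (hν : IsCondLaw m μ Y ν) {F : Ω × S → ℝ}
    (hF : Measurable[m.prod mS] F) :
    ∀ᵐ ω ∂μ, Integrable (fun y => F (ω, y)) (ν ω) →
      condE m μ (fun ω => F (ω, Y ω)) ω = ∫ y, F (ω, y) ∂(ν ω) := by
  filter_upwards [hν.condLExp_ae_eq (fun q => ENNReal.ofReal (F q)) hF.ennreal_ofReal,
    hν.condLExp_ae_eq (fun q => ENNReal.ofReal (-F q)) hF.neg.ennreal_ofReal] with ω h1 h2 hi
  rw [condE, h1, h2, integral_eq_lintegral_pos_part_sub_lintegral_neg_part hi]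

open ProbabilityTheory in
theorem IsCondLaw.condCov_eq (hν : IsCondLaw m μ Y ν) {f g : S → ℝ} (hf : Measurable f)
    (hg : Measurable g) :
    ∀ᵐ ω ∂μ, MemLp f 2 (ν ω) → MemLp g 2 (ν ω) →
      condCov m μ (fun ω => f (Y ω)) (fun ω => g (Y ω)) ω = cov[f, g; ν ω] := by
  have hsnd : ∀ {h : S → ℝ}, Measurable h → Measurable[m.prod mS] fun q : Ω × S => h q.2 :=
    fun hh => hh.comp (@measurable_snd Ω S m mS)
  have hfst : ∀ {h : Ω → ℝ}, Measurable[m] h → Measurable[m.prod mS] fun q : Ω × S => h q.1 :=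
    fun hh => hh.comp (@measurable_fst Ω S m mS)
  -- The centerings are `m`-measurable functions of `ω`, so the centered product is a jointly
  -- measurable function of `(ω, Y ω)`.
  have h3 := hν.condE_eq (F := fun q => (f q.2 - condE m μ (fun ω => f (Y ω)) q.1) *
    (g q.2 - condE m μ (fun ω => g (Y ω)) q.1))
    (((hsnd hf).sub (hfst (measurable_condE m μ _))).mul
      ((hsnd hg).sub (hfst (measurable_condE m μ _))))
  filter_upwards [hν.condE_eq (hsnd hf), hν.condE_eq (hsnd hg), h3] with ω h1 h2 h3 hf2 hg2
  have := hν.isProbabilityMeasure ω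
  have e1 := h1 (hf2.integrable one_le_two)
  have e2 := h2 (hg2.integrable one_le_two)
  rw [condCov, h3, covariance, e1, e2]
  exact (hf2.sub (memLp_const _)).integrable_mul (hg2.sub (memLp_const _))

end CondLaw

/-! ### Covariance inequalities by truncation. -/

section Truncation

open ProbabilityTheory

theorem abs_covariance_le_integral {S : Type*} [MeasurableSpace S] {P : Measure S}
    [IsProbabilityMeasure P] {X Z : S → ℝ} (hX : MemLp X 2 P) (hZ : MemLp Z 2 P) :
    |cov[X, Z; P]| ≤ ∫ y, |X y| * |Z y| ∂P + (∫ y, |X y| ∂P) * ∫ y, |Z y| ∂P := by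
  rw [covariance_eq_sub hX hZ]
  refine (abs_sub _ _).trans (add_le_add ?_ ?_)
  · refine abs_integral_le_integral_abs.trans (le_of_eq ?_)
    simp [abs_mul]
  · rw [abs_mul]
    exact mul_le_mul abs_integral_le_integral_abs abs_integral_le_integral_abs (abs_nonneg _)
      (integral_nonneg fun _ => abs_nonneg _)

variable {S : Type*} [MeasurableSpace S] {P : Measure S}

/-- An envelope: a measurable function `U ≥ 1` with `p`-th moment at most `R`. -/
structure IsEnvelope (P : Measure S) (p R : ℝ) (U : S → ℝ) : Prop where
  measurable : Measurable U
  one_le : ∀ y, 1 ≤ U y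
  integrable : Integrable (fun y => U y ^ p) P
  integral_le : ∫ y, U y ^ p ∂P ≤ R

variable {p R : ℝ} {U : S → ℝ}

theorem IsEnvelope.one_le_bound [IsProbabilityMeasure P] (hU : IsEnvelope P p R U) (hp : 0 ≤ p) : 1 ≤ R := by
  refine le_trans ?_ hU.integral_le
  have : ∫ _ : S, (1 : ℝ) ∂P ≤ ∫ y, U y ^ p ∂P :=
    integral_mono (integrable_const _) hU.integrable
      fun y => Real.one_le_rpow (hU.one_le y) hp
  simpa using this

theorem IsEnvelope.integrable_pow (hU : IsEnvelope P p R U) {k : ℕ} (hk : (k : ℝ) ≤ p) :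
    Integrable (fun y => U y ^ k) P := by
  refine hU.integrable.mono' (hU.measurable.pow_const k).aestronglyMeasurable
    (ae_of_all _ fun y => ?_)
  have h0 : (0 : ℝ) ≤ U y := zero_le_one.trans (hU.one_le y)
  rw [Real.norm_of_nonneg (by positivity), ← Real.rpow_natCast]
  exact Real.rpow_le_rpow_of_exponent_le (hU.one_le y) hk

theorem IsEnvelope.integral_pow_le (hU : IsEnvelope P p R U) {k : ℕ} (hk : (k : ℝ) ≤ p) :
    ∫ y, U y ^ k ∂P ≤ R := by
  refine le_trans (integral_mono (hU.integrable_pow hk) hU.integrable fun y => ?_)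
    hU.integral_le
  simp only
  rw [← Real.rpow_natCast]
  exact Real.rpow_le_rpow_of_exponent_le (hU.one_le y) hk

theorem IsEnvelope.memLp_two (hU : IsEnvelope P p R U) {r : ℕ} (hr : (2 * r : ℕ) ≤ p)
    {F : S → ℝ} (hF : Measurable F) (hFU : ∀ y, |F y| ≤ U y ^ r) : MemLp F 2 P := by
  rw [memLp_two_iff_integrable_sq hF.aestronglyMeasurable]
  refine (hU.integrable_pow hr).mono' (hF.pow_const 2).aestronglyMeasurable
    (ae_of_all _ fun y => ?_)
  rw [Real.norm_eq_abs, abs_pow, mul_comm 2 r, pow_mul]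
  exact pow_le_pow_left₀ (abs_nonneg _) (hFU y) 2

theorem IsEnvelope.integral_abs_le (hU : IsEnvelope P p R U) {r : ℕ} (hr : ((r : ℕ) : ℝ) ≤ p)
    {F : S → ℝ} (hFU : ∀ y, |F y| ≤ U y ^ r) : ∫ y, |F y| ∂P ≤ R :=
  (integral_mono_of_nonneg (ae_of_all _ fun _ => abs_nonneg _) (hU.integrable_pow hr)
    (ae_of_all _ hFU)).trans (hU.integral_pow_le hr)

theorem IsEnvelope.abs_cov_le [IsProbabilityMeasure P] (hU : IsEnvelope P p R U) {r : ℕ}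
    (hr : ((r + r : ℕ) : ℝ) ≤ p) {F H : S → ℝ} (hF : Measurable F) (hH : Measurable H)
    (hFU : ∀ y, |F y| ≤ U y ^ r) (hHU : ∀ y, |H y| ≤ U y ^ r) :
    |cov[F, H; P]| ≤ 2 * R ^ 2 := by
  have hp0 : 0 ≤ p := le_trans (by positivity) hr
  have hR := hU.one_le_bound hp0
  have hr' : ((r : ℕ) : ℝ) ≤ p := by push_cast at hr; linarith [(Nat.cast_nonneg r : (0:ℝ) ≤ r)]
  have hrr : ((2 * r : ℕ) : ℝ) ≤ p := by rwa [two_mul]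
  refine (abs_covariance_le_integral (hU.memLp_two hrr hF hFU) (hU.memLp_two hrr hH hHU)).trans ?_
  have i1 : ∫ y, |F y| * |H y| ∂P ≤ R := by
    simp only [← abs_mul]
    refine hU.integral_abs_le hr fun y => ?_
    rw [abs_mul, pow_add]
    exact mul_le_mul (hFU y) (hHU y) (abs_nonneg _)
      (pow_nonneg (zero_le_one.trans (hU.one_le y)) _)
  have i3 : (∫ y, |F y| ∂P) * ∫ y, |H y| ∂P ≤ R * R :=
    mul_le_mul (hU.integral_abs_le hr' hFU) (hU.integral_abs_le hr' hHU)
      (integral_nonneg fun _ => abs_nonneg _) (by linarith)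
  nlinarith

/-- Tail bound: a function dominated by `2 U^r` and vanishing where `U ≤ c`. -/
theorem IsEnvelope.integral_tail_mul_le (hU : IsEnvelope P p R U) {r q : ℕ}
    (hrq : ((r + q : ℕ) : ℝ) ≤ p) {D H : S → ℝ} {c : ℝ} (hc : 1 ≤ c)
    (hDU : ∀ y, |D y| ≤ 2 * U y ^ r) (hD0 : ∀ y, U y ≤ c → D y = 0)
    (hHU : ∀ y, |H y| ≤ U y ^ q) :
    ∫ y, |D y| * |H y| ∂P ≤ 2 * R * c ^ (((r + q : ℕ) : ℝ) - p) := by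
  -- Where `U > c`, write `U ^ (r + q) = U ^ (r + q - p) * U ^ p`; the exponent `r + q - p` is
  -- nonpositive, so the first factor is at most its value at `c`.
  have key : ∀ y, |D y| * |H y| ≤ 2 * c ^ (((r + q : ℕ) : ℝ) - p) * U y ^ p := by
    intro y
    have h0 : (0 : ℝ) < U y := zero_lt_one.trans_le (hU.one_le y)
    have hc0 : 0 < c := zero_lt_one.trans_le hc
    rcases le_or_gt (U y) c with h | h
    · rw [hD0 y h, abs_zero, zero_mul]; positivity
    · calc |D y| * |H y| ≤ (2 * U y ^ r) * U y ^ q :=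
            mul_le_mul (hDU y) (hHU y) (abs_nonneg _) (by positivity)
        _ = 2 * U y ^ (((r + q : ℕ) : ℝ) - p + p) := by
            rw [sub_add_cancel, Real.rpow_natCast, pow_add]; ring
        _ = 2 * (U y ^ (((r + q : ℕ) : ℝ) - p) * U y ^ p) := by rw [Real.rpow_add h0]
        _ ≤ 2 * (c ^ (((r + q : ℕ) : ℝ) - p) * U y ^ p) := by
            have := Real.rpow_le_rpow_of_nonpos hc0 h.le (sub_nonpos.2 hrq)
            gcongr 2 * (?_ * _)
        _ = _ := by ring
  calc ∫ y, |D y| * |H y| ∂P ≤ ∫ y, 2 * c ^ (((r + q : ℕ) : ℝ) - p) * U y ^ p ∂P :=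
        integral_mono_of_nonneg (ae_of_all _ fun y => by positivity)
          (hU.integrable.const_mul _) (ae_of_all _ key)
    _ = 2 * c ^ (((r + q : ℕ) : ℝ) - p) * ∫ y, U y ^ p ∂P := integral_const_mul _ _
    _ ≤ 2 * c ^ (((r + q : ℕ) : ℝ) - p) * R :=
        mul_le_mul_of_nonneg_left hU.integral_le (by positivity)
    _ = _ := by ring

theorem IsEnvelope.abs_cov_tail_le [IsProbabilityMeasure P] (hU : IsEnvelope P p R U) {r : ℕ}
    (hr : ((r + r : ℕ) : ℝ) ≤ p) {D H : S → ℝ} (hD : Measurable D) (hH : Measurable H)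
    {c : ℝ} (hc : 1 ≤ c) (hDU : ∀ y, |D y| ≤ 2 * U y ^ r) (hD0 : ∀ y, U y ≤ c → D y = 0)
    (hHU : ∀ y, |H y| ≤ U y ^ r) :
    |cov[D, H; P]| ≤ 4 * R ^ 2 * c ^ (((r + r : ℕ) : ℝ) - p) := by
  have hp0 : 0 ≤ p := le_trans (by positivity) hr
  have hR := hU.one_le_bound hp0
  have hr' : ((r : ℕ) : ℝ) ≤ p := by push_cast at hr; linarith [(Nat.cast_nonneg r : (0:ℝ) ≤ r)]
  have hrr : ((2 * r : ℕ) : ℝ) ≤ p := by rwa [two_mul]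
  have hc0 : 0 < c := zero_lt_one.trans_le hc
  -- `D` is dominated by `2 * U ^ r`, so the envelope lemma is applied to half of it.
  have hD2 : MemLp D 2 P := by
    have : MemLp (fun y => 2⁻¹ * D y) 2 P := by
      refine hU.memLp_two hrr (hD.const_mul _) fun y => ?_
      rw [abs_mul, abs_of_pos (by norm_num : (0 : ℝ) < 2⁻¹)]
      linarith [hDU y]
    have h := this.const_mul 2
    simpa [← mul_assoc] using h
  have hH2 : MemLp H 2 P := hU.memLp_two hrr hH hHU
  refine (abs_covariance_le_integral hD2 hH2).trans ?_
  have h1 := hU.integral_tail_mul_le hr hc hDU hD0 hHU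
  -- The case `H = 1` bounds the first moment of the tail, needed for the product of means in the
  -- covariance.
  have h2 := hU.integral_tail_mul_le (q := 0) (H := fun _ => 1) (by simpa using hr') hc hDU hD0 (by simp)
  simp only [abs_one, mul_one, add_zero] at h2
  have h3 : ∫ y, |H y| ∂P ≤ R := hU.integral_abs_le hr' hHU
  have h4 : c ^ ((r : ℝ) - p) ≤ c ^ (((r + r : ℕ) : ℝ) - p) := by
    refine Real.rpow_le_rpow_of_exponent_le hc ?_
    push_cast; linarith [(Nat.cast_nonneg r : (0:ℝ) ≤ r)]
  set e := c ^ (((r + r : ℕ) : ℝ) - p)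
  have he : 0 < e := by positivity
  have h5 : (∫ y, |D y| ∂P) * ∫ y, |H y| ∂P ≤ (2 * R * e) * R :=
    mul_le_mul (h2.trans (by gcongr)) h3 (integral_nonneg fun _ => abs_nonneg _) (by positivity)
  have h6 : 2 * R * e ≤ 2 * R ^ 2 * e := by gcongr; nlinarith
  nlinarith

/-- Covariance inequality for unbounded functions from covariance inequalities for their
truncations. -/
theorem IsEnvelope.abs_cov_le_of_trunc [IsProbabilityMeasure P] (hU : IsEnvelope P p R U) {r : ℕ}
    (hr : ((r + r : ℕ) : ℝ) < p) {F H : S → ℝ} (hF : Measurable F) (hH : Measurable H)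
    {Fc Hc : ℕ → S → ℝ} (hFc : ∀ c, Measurable (Fc c)) (hHc : ∀ c, Measurable (Hc c))
    (hFU : ∀ y, |F y| ≤ U y ^ r) (hHU : ∀ y, |H y| ≤ U y ^ r)
    (hFcU : ∀ c y, |Fc c y| ≤ U y ^ r) (hHcU : ∀ c y, |Hc c y| ≤ U y ^ r)
    (hFF : ∀ (c : ℕ) y, U y ≤ c → Fc c y = F y) (hHH : ∀ (c : ℕ) y, U y ≤ c → Hc c y = H y)
    {K t : ℝ} (hK : 0 ≤ K) (ht : 0 ≤ t)
    (hcov : ∀ c : ℕ, 1 ≤ c → |cov[Fc c, Hc c; P]| ≤ K * (c : ℝ) ^ (r + r) * t) :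
    |cov[F, H; P]| ≤ (K * 2 ^ (r + r) + 8 * R ^ 2) * t ^ (1 - ((r + r : ℕ) : ℝ) / p) := by
  have hp0 : 0 < p := lt_of_le_of_lt (by positivity) hr
  have hR := hU.one_le_bound hp0.le
  have hrr : ((2 * r : ℕ) : ℝ) ≤ p := by rw [two_mul]; exact hr.le
  have hF2 := hU.memLp_two hrr hF hFU
  have hH2 := hU.memLp_two hrr hH hHU
  have hFc2 := fun c => hU.memLp_two hrr (hFc c) (hFcU c)
  have hHc2 := fun c => hU.memLp_two hrr (hHc c) (hHcU c)
  have htail : ∀ c : ℕ, 1 ≤ c →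
      |cov[F, H; P]| ≤ K * (c : ℝ) ^ (r + r) * t + 8 * R ^ 2 * (c : ℝ) ^ (((r + r : ℕ) : ℝ) - p) := by
    intro c hc
    have hc' : (1 : ℝ) ≤ c := by exact_mod_cast hc
    -- One truncated covariance plus two covariances with a factor vanishing on `U ≤ c`.
    have e : cov[F, H; P] = cov[Fc c, Hc c; P] + cov[F - Fc c, H; P] + cov[H - Hc c, Fc c; P] := by
      rw [covariance_sub_left hF2 (hFc2 c) hH2, covariance_sub_left hH2 (hHc2 c) (hFc2 c),
        covariance_comm H, covariance_comm (Hc c)]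
      ring
    have b1 := hU.abs_cov_tail_le hr.le (hF.sub (hFc c)) hH hc' (D := F - Fc c)
      (fun y => (abs_sub _ _).trans (by linarith [hFU y, hFcU c y]))
      (fun y hy => by simp [hFF c y hy]) hHU
    have b2 := hU.abs_cov_tail_le hr.le (hH.sub (hHc c)) (hFc c) hc' (D := H - Hc c)
      (fun y => (abs_sub _ _).trans (by linarith [hHU y, hHcU c y]))
      (fun y hy => by simp [hHH c y hy]) (hFcU c)
    rw [e]
    refine (abs_add_three _ _ _).trans ?_
    linarith [hcov c hc]
  -- The level `c = ⌈s ^ (-1/p)⌉` makes both `c ^ (2r) * s` and `c ^ (2r - p)` of order `s ^ (1 -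
  -- 2r/p)`. Rounding up costs at most a factor 2 in `c`, whence `2 ^ (r + r)`. Allowing any `s ≥ t`
  -- keeps `t = 0` within reach.
  have hmain : ∀ s : ℝ, 0 < s → s ≤ 1 → t ≤ s →
      |cov[F, H; P]| ≤ (K * 2 ^ (r + r) + 8 * R ^ 2) * s ^ (1 - ((r + r : ℕ) : ℝ) / p) := by
    intro s hs hs1 hts
    set z := s ^ (-(1 / p)) with hz
    have hz1 : 1 ≤ z := Real.one_le_rpow_of_pos_of_le_one_of_nonpos hs hs1 (by
      have := one_div_pos.2 hp0; linarith)
    have hz0 : 0 < z := zero_lt_one.trans_le hz1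
    have hc1 : 1 ≤ ⌈z⌉₊ := Nat.one_le_ceil_iff.2 hz0
    have hcz : z ≤ (⌈z⌉₊ : ℝ) := Nat.le_ceil z
    have hcz2 : (⌈z⌉₊ : ℝ) ≤ 2 * z := by linarith [Nat.ceil_lt_add_one hz0.le]
    refine (htail _ hc1).trans ?_
    have a1 : K * (⌈z⌉₊ : ℝ) ^ (r + r) * t ≤ K * (2 * z) ^ (r + r) * s := by gcongr
    have a2 : (⌈z⌉₊ : ℝ) ^ (((r + r : ℕ) : ℝ) - p) ≤ z ^ (((r + r : ℕ) : ℝ) - p) :=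
      Real.rpow_le_rpow_of_nonpos hz0 hcz (by linarith)
    have e1 : z ^ (r + r) * s = s ^ (1 - ((r + r : ℕ) : ℝ) / p) := by
      rw [hz, ← Real.rpow_natCast, ← Real.rpow_mul hs.le]
      nth_rewrite 2 [← Real.rpow_one s]
      rw [← Real.rpow_add hs]
      congr 1
      ring
    have e2 : z ^ (((r + r : ℕ) : ℝ) - p) = s ^ (1 - ((r + r : ℕ) : ℝ) / p) := by
      rw [hz, ← Real.rpow_mul hs.le]
      congr 1
      field_simp
      ring
    have a3 : K * (2 * z) ^ (r + r) * s = K * 2 ^ (r + r) * s ^ (1 - ((r + r : ℕ) : ℝ) / p) := by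
      rw [← e1, mul_pow]; ring
    rw [e2] at a2
    have a4 : 8 * R ^ 2 * (⌈z⌉₊ : ℝ) ^ (((r + r : ℕ) : ℝ) - p)
        ≤ 8 * R ^ 2 * s ^ (1 - ((r + r : ℕ) : ℝ) / p) := by gcongr
    linarith
  have hexp : 0 < 1 - ((r + r : ℕ) : ℝ) / p := by
    rw [sub_pos, div_lt_one hp0]; exact hr
  rcases le_or_gt t 1 with h1 | h1
  -- For `t = 0` no finite level is optimal; the bound is obtained by letting `s` decrease to 0.
  · rcases ht.eq_or_lt with h0 | h0
    · have hlim : Tendsto (fun s : ℝ => (K * 2 ^ (r + r) + 8 * R ^ 2) *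
          s ^ (1 - ((r + r : ℕ) : ℝ) / p)) (𝓝[>] 0)
          (𝓝 ((K * 2 ^ (r + r) + 8 * R ^ 2) * 0 ^ (1 - ((r + r : ℕ) : ℝ) / p))) :=
        (((Real.continuous_rpow_const hexp.le).tendsto 0).mono_left nhdsWithin_le_nhds).const_mul _
      rw [← h0]
      refine ge_of_tendsto hlim ?_
      filter_upwards [Ioo_mem_nhdsGT zero_lt_one] with s hs
      exact hmain s hs.1 hs.2.le (h0 ▸ hs.1.le)
    · exact hmain t h0 h1 le_rfl
  -- For `t > 1` the moment bound alone suffices.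
  · have h2 : |cov[F, H; P]| ≤ (K * 2 ^ (r + r) + 8 * R ^ 2) * 1 ^ (1 - ((r + r : ℕ) : ℝ) / p) := by
      have i4 : 0 ≤ K * 2 ^ (r + r) := by positivity
      rw [Real.one_rpow]
      nlinarith [hU.abs_cov_le hr.le hF hH hFU hHU]
    exact h2.trans (by gcongr)

end Truncation

/-! ### Counting pairs of nodes in the network. -/

section Network

variable {n : ℕ} (G : SimpleGraph (Fin n))

theorem mem_shell {i j : Fin n} {s : ℕ∞} : j ∈ shell G i s ↔ G.edist i j = s := by
  simp [shell]

theorem mem_nbhd {i j : Fin n} {r : ℝ} : j ∈ nbhd G i r ↔ toER (G.edist i j) ≤ (r : EReal) := by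
  simp [nbhd]

theorem mem_openNbhd {i j : Fin n} {s : ℕ∞} : j ∈ openNbhd G i s ↔ G.edist i j < s := by
  simp [openNbhd]

/-- Every pair of nodes, connected or not, lies in exactly one shell, so series over distances are
finite double sums over nodes. -/
theorem hasSum_shell {M : Type*} [AddCommMonoid M] [TopologicalSpace M] [ContinuousAdd M]
    (f : ℕ∞ → Fin n → Fin n → M) :
    HasSum (fun s : ℕ∞ => ∑ i, ∑ j ∈ shell G i s, f s i j) (∑ i, ∑ j, f (G.edist i j) i j) := by
  classical
  have h : (fun s : ℕ∞ => ∑ i, ∑ j ∈ shell G i s, f s i j)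
      = fun s => ∑ i, ∑ j, if G.edist i j = s then f s i j else 0 := by
    funext s
    refine Finset.sum_congr rfl fun i _ => ?_
    rw [← Finset.sum_filter]
    exact Finset.sum_congr (by ext j; simp [mem_shell]) fun _ _ => rfl
  rw [h]
  refine hasSum_sum fun i _ => hasSum_sum fun j _ => ?_
  have := hasSum_single (f := fun s : ℕ∞ => if G.edist i j = s then f s i j else 0)
    (G.edist i j) (fun s hs => if_neg (Ne.symm hs))
  simpa using this

theorem hacZeroMean_apply {v : ℕ} (κ : EReal → ℝ) (b : ℝ) (y : Fin n → EuclideanSpace ℝ (Fin v))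
    (k l : Fin v) :
    hacZeroMean κ b G y k l
      = (n : ℝ)⁻¹ * ∑ i, ∑ j, weight κ b (G.edist i j) * (y i k * y j l) := by
  have h := hasSum_shell G fun s i j =>
    (weight κ b s • (n : ℝ)⁻¹ • Matrix.of fun k l => y i k * y j l : Matrix (Fin v) (Fin v) ℝ)
  have e : hacZeroMean κ b G y = ∑ i, ∑ j, (weight κ b (G.edist i j) • (n : ℝ)⁻¹ •
      Matrix.of fun k l => y i k * y j l : Matrix (Fin v) (Fin v) ℝ) := by
    rw [← h.tsum_eq, hacZeroMean]
    congr 1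
    funext s
    simp only [sampleOmega, Finset.smul_sum]
  rw [e]
  simp only [Matrix.sum_apply, Matrix.smul_apply, Matrix.of_apply, smul_eq_mul, Finset.mul_sum]
  exact Finset.sum_congr rfl fun i _ => Finset.sum_congr rfl fun j _ => by ring

theorem sum_shell_density (s : ℕ∞) : shellDensity G s 1 = (n : ℝ)⁻¹ * ∑ i, ∑ _j ∈ shell G i s, 1 := by
  simp [shellDensity]

theorem tsum_weight_eq (κ : EReal → ℝ) (b e : ℝ) (θ : ℕ∞ → ℝ) :
    (∑' s : ℕ∞, if 1 ≤ s then |weight κ b s - 1| * shellDensity G s 1 * θ s ^ e else 0)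
      = (n : ℝ)⁻¹ * ∑ i, ∑ j, if 1 ≤ G.edist i j then
          |weight κ b (G.edist i j) - 1| * θ (G.edist i j) ^ e else 0 := by
  rw [Finset.mul_sum]
  simp only [Finset.mul_sum]
  have h := hasSum_shell G fun s _ _ =>
    (n : ℝ)⁻¹ * if 1 ≤ s then |weight κ b s - 1| * θ s ^ e else 0
  rw [← h.tsum_eq]
  congr 1
  funext s
  split_ifs
  · simp only [sum_shell_density, Finset.mul_sum, Finset.sum_mul]
    exact Finset.sum_congr rfl fun i _ => Finset.sum_congr rfl fun j _ => by ring
  · simp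

theorem Delta_eq_zero {s : ℕ∞} (hs : ∀ i j, G.edist i j ≠ s) (m k : ℝ) : Delta G s m k = 0 := by
  rw [Delta]
  have : ∀ i, IsEmpty {j // j ∈ shell G i s} := fun i => ⟨fun j => hs i j.1 ((mem_shell G).1 j.2)⟩
  simp [Real.iSup_of_isEmpty]

/-- Only finitely many distances occur in a finite graph, so this makes the series of `cStat`
summable. -/
theorem cStat_eq_zero {s : ℕ∞} (hs : ∀ i j, G.edist i j ≠ s) (m k : ℝ) : cStat G s m k = 0 := by
  rw [cStat]
  have : ∀ α : {α : ℝ // 1 < α}, Delta G s m (k * α.1) ^ (1 / α.1) *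
      shellDensity G s (α.1 / (α.1 - 1)) ^ (1 - 1 / α.1) = 0 := by
    intro α
    have : (1 : ℝ) / α.1 ≠ 0 := one_div_ne_zero (by linarith [α.2])
    rw [Delta_eq_zero G hs, Real.zero_rpow this, zero_mul]
  rw [iInf_congr this, Real.iInf_const_zero]

/-- Number of nodes within distance `b` of `i` that are at least as far from `j` as `i` is. -/
def outerCard (b : ℝ) (i j : Fin n) : ℝ := ((nbhd G i b \ openNbhd G j (G.edist i j)).card : ℝ)

/-- For each `α`, the maximum over the shell is pulled out of the inner sum, and Hölder's inequality
over `i` with exponents `α` and `α / (α - 1)` separates it from the shell size. -/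
theorem le_cStat (s : ℕ∞) (b : ℝ) :
    (n : ℝ)⁻¹ * ∑ i, ∑ j ∈ shell G i s, ((nbhd G i b \ openNbhd G j s).card : ℝ) ^ 2
      ≤ cStat G s b 2 := by
  have : Nonempty {α : ℝ // 1 < α} := ⟨⟨2, one_lt_two⟩⟩
  refine le_ciInf fun ⟨α, hα⟩ => ?_
  have hα0 : 0 < α := by linarith
  have hα1 : 0 < α - 1 := by linarith
  set S : Fin n → ℝ := fun i => ⨆ j : {j // j ∈ shell G i s},
    ((nbhd G i b \ openNbhd G j.1 s).card : ℝ) ^ (2 * α) with hS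
  have hS0 : ∀ i, 0 ≤ S i := fun i => Real.iSup_nonneg fun j => by positivity
  have h1 : ∀ i, ∑ j ∈ shell G i s, ((nbhd G i b \ openNbhd G j s).card : ℝ) ^ 2
      ≤ S i ^ (1 / α) * ((shell G i s).card : ℝ) := by
    intro i
    rw [mul_comm, ← nsmul_eq_mul]
    refine Finset.sum_le_card_nsmul _ _ _ fun j hj => ?_
    have h2 : ((nbhd G i b \ openNbhd G j s).card : ℝ) ^ (2 * α) ≤ S i :=
      le_ciSup (f := fun j : {j // j ∈ shell G i s} =>
        ((nbhd G i b \ openNbhd G j.1 s).card : ℝ) ^ (2 * α)) (Set.finite_range _).bddAbove ⟨j, hj⟩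
    refine le_trans (le_of_eq ?_) (Real.rpow_le_rpow (by positivity) h2 (by positivity))
    rw [← Real.rpow_mul (by positivity), ← Real.rpow_natCast]
    congr 1
    field_simp
    norm_num
  have hconj : α.HolderConjugate (α / (α - 1)) := Real.HolderConjugate.conjExponent hα
  have h2 := Real.inner_le_Lp_mul_Lq_of_nonneg Finset.univ hconj
    (f := fun i => S i ^ (1 / α)) (g := fun i => ((shell G i s).card : ℝ))
    (fun i _ => Real.rpow_nonneg (hS0 i) _) (fun i _ => by positivity)
  have h3 : ∀ i, (S i ^ (1 / α)) ^ α = S i := fun i => by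
    rw [← Real.rpow_mul (hS0 i), one_div_mul_cancel hα0.ne', Real.rpow_one]
  simp only [h3] at h2
  have he : 1 / (α / (α - 1)) = 1 - 1 / α := by field_simp
  rw [he] at h2
  have he0 : 0 ≤ 1 - 1 / α := by rw [← he]; positivity
  -- The factor `1/n` is shared between the two Hölder factors to turn sums into averages; for `n =
  -- 0` both sides are 0.
  have hn : ((n : ℝ)⁻¹) = ((n : ℝ)⁻¹) ^ (1 / α) * ((n : ℝ)⁻¹) ^ (1 - 1 / α) := by
    rcases Nat.eq_zero_or_pos n with h | h
    · have : (1 : ℝ) / α ≠ 0 := by positivity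
      subst h
      simp [Real.zero_rpow (inv_ne_zero hα0.ne')]
    · rw [← Real.rpow_add (by positivity)]
      simp
  calc (n : ℝ)⁻¹ * ∑ i, ∑ j ∈ shell G i s, ((nbhd G i b \ openNbhd G j s).card : ℝ) ^ 2
      ≤ (n : ℝ)⁻¹ * ((∑ i, S i) ^ (1 / α) *
          (∑ i, ((shell G i s).card : ℝ) ^ (α / (α - 1))) ^ (1 - 1 / α)) := by
        gcongr
        exact (Finset.sum_le_sum fun i _ => h1 i).trans h2
    _ = _ := by
        simp only [Delta, shellDensity]
        rw [Real.mul_rpow (by positivity) (Finset.sum_nonneg fun i _ => hS0 i),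
          Real.mul_rpow (by positivity) (Finset.sum_nonneg fun i _ => by positivity)]
        conv_lhs => rw [hn]
        ring

theorem sum_outerCard_le_tsum_cStat (b : ℝ) {α : ℕ∞ → ℝ} (hα : ∀ s, 0 ≤ α s) :
    (n : ℝ)⁻¹ * ∑ i, ∑ j, outerCard G b i j ^ 2 * α (G.edist i j)
      ≤ ∑' s : ℕ∞, cStat G s b 2 * α s := by
  classical
  have h := hasSum_shell G fun s i j =>
    (n : ℝ)⁻¹ * (((nbhd G i b \ openNbhd G j s).card : ℝ) ^ 2 * α s)
  have hsum : Summable fun s : ℕ∞ => cStat G s b 2 * α s := by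
    -- Without summability `∑'` would take its default value 0 and the inequality could fail.
    refine summable_of_ne_finset_zero
      (s := Finset.univ.image fun q : Fin n × Fin n => G.edist q.1 q.2) fun s hs => ?_
    rw [cStat_eq_zero G, zero_mul]
    intro i j hij
    exact hs (Finset.mem_image.2 ⟨(i, j), Finset.mem_univ _, hij⟩)
  rw [Finset.mul_sum]
  simp only [Finset.mul_sum]
  refine hasSum_le (fun s => ?_) h hsum.hasSum
  have := mul_le_mul_of_nonneg_right (le_cStat G s b) (hα s)
  refine le_trans (le_of_eq ?_) this
  simp only [Finset.mul_sum, Finset.sum_mul]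
  exact Finset.sum_congr rfl fun i _ => Finset.sum_congr rfl fun j _ => by ring

open Classical in
/-- Indicator of the pairs of nodes within distance `b`. -/
def nearInd (b : ℝ) (i j : Fin n) : ℝ := if toER (G.edist i j) ≤ (b : EReal) then 1 else 0

theorem nearInd_comm (b : ℝ) (i j : Fin n) : nearInd G b i j = nearInd G b j i := by
  rw [nearInd, nearInd, G.edist_comm]

theorem nearInd_nonneg (b : ℝ) (i j : Fin n) : 0 ≤ nearInd G b i j := by
  rw [nearInd]; split_ifs <;> norm_num

theorem sum_nearInd (b : ℝ) (i : Fin n) : ∑ j, nearInd G b i j = ((nbhd G i b).card : ℝ) := by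
  simp [nearInd, nbhd]

theorem nbhdDensity_eq (b : ℝ) : nbhdDensity G b = (n : ℝ)⁻¹ * ∑ i, ∑ j, nearInd G b i j := by
  simp only [sum_nearInd, nbhdDensity]

theorem outerCard_eq (b : ℝ) (i j : Fin n) :
    outerCard G b i j
      = ∑ l, nearInd G b i l * if G.edist i j ≤ G.edist j l then 1 else 0 := by
  have : nbhd G i b \ openNbhd G j (G.edist i j)
      = Finset.univ.filter fun l => toER (G.edist i l) ≤ (b : EReal) ∧ G.edist i j ≤ G.edist j l := by
    ext l
    simp [mem_nbhd, mem_openNbhd]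
  rw [outerCard, this, ← Finset.sum_boole]
  refine Finset.sum_congr rfl fun l _ => ?_
  rw [nearInd]
  split_ifs <;> simp_all

/-- Distance between the pairs `{i, j}` and `{i', j'}`. -/
def pairDist (i j i' j' : Fin n) : ℕ∞ :=
  min (min (G.edist i i') (G.edist i j')) (min (G.edist j i') (G.edist j j'))

theorem pairDist_le_setDist [DecidableEq (Fin n)] (i j i' j' : Fin n) :
    pairDist G i j i' j' ≤ setDist G {i, j} {i', j'} := by
  refine le_iInf₂ fun x hx => le_iInf₂ fun y hy => ?_
  rw [Finset.mem_insert, Finset.mem_singleton] at hx hy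
  rcases hx with rfl | rfl <;> rcases hy with rfl | rfl <;> simp [pairDist]

/-- Summing a function of the distance between pairs over two near pairs. -/
theorem sum_pairDist_le (b : ℝ) {α : ℕ∞ → ℝ} (hα : ∀ s, 0 ≤ α s) :
    ∑ i, ∑ j, ∑ i', ∑ j', nearInd G b i j * nearInd G b i' j' * α (pairDist G i j i' j')
      ≤ 4 * ∑ i, ∑ j, outerCard G b i j ^ 2 * α (G.edist i j) := by
  set A := nearInd G b with hA
  set T : Fin n → Fin n → Fin n → Fin n → ℝ := fun i j i' j' =>
    if G.edist i i' ≤ G.edist i' j ∧ G.edist i i' ≤ G.edist i j' then α (G.edist i i') else 0 with hT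
  have hT0 : ∀ i j i' j', 0 ≤ T i j i' j' := fun i j i' j' => by
    simp only [hT]; split_ifs <;> simp [hα]
  -- The minimum of the four cross distances is attained. If by `(i, i')`, then `j` is at least that
  -- far from `i'`, and `j'` from `i`; this is the event in `T`. The distance between `j` and `j'`
  -- plays no further part.
  have hpt : ∀ i j i' j', α (pairDist G i j i' j')
      ≤ T i j i' j' + T j i i' j' + T i j j' i' + T j i j' i' := by
    intro i j i' j'
    have n1 := hT0 i j i' j'
    have n2 := hT0 j i i' j'
    have n3 := hT0 i j j' i'
    have n4 := hT0 j i j' i'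
    have hle : ∀ x x' y y', pairDist G i j i' j' = G.edist x x' →
        G.edist x x' ≤ G.edist x' y → G.edist x x' ≤ G.edist x y' →
        α (pairDist G i j i' j') ≤ T x y x' y' := by
      intro x x' y y' h1 h2 h3
      simp only [hT]
      rw [if_pos ⟨h2, h3⟩, h1]
    have m1 : pairDist G i j i' j' ≤ G.edist i i' := by simp [pairDist]
    have m2 : pairDist G i j i' j' ≤ G.edist i j' := by simp [pairDist]
    have m3 : pairDist G i j i' j' ≤ G.edist j i' := by simp [pairDist]
    have m4 : pairDist G i j i' j' ≤ G.edist j j' := by simp [pairDist]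
    have hcases : pairDist G i j i' j' = G.edist i i' ∨ pairDist G i j i' j' = G.edist i j' ∨
        pairDist G i j i' j' = G.edist j i' ∨ pairDist G i j i' j' = G.edist j j' := by
      rcases min_choice (min (G.edist i i') (G.edist i j')) (min (G.edist j i') (G.edist j j'))
        with h | h
      · rcases min_choice (G.edist i i') (G.edist i j') with h' | h'
        · exact Or.inl (h.trans h')
        · exact Or.inr (Or.inl (h.trans h'))
      · rcases min_choice (G.edist j i') (G.edist j j') with h' | h'
        · exact Or.inr (Or.inr (Or.inl (h.trans h')))
        · exact Or.inr (Or.inr (Or.inr (h.trans h')))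
    rcases hcases with h | h | h | h
    · have := hle i i' j j' h (by rw [G.edist_comm (u := i')]; rw [← h]; exact m3)
        (by rw [← h]; exact m2)
      linarith
    · have := hle i j' j i' h (by rw [G.edist_comm (u := j')]; rw [← h]; exact m4)
        (by rw [← h]; exact m1)
      linarith
    · have := hle j i' i j' h (by rw [G.edist_comm (u := i')]; rw [← h]; exact m1)
        (by rw [← h]; exact m4)
      linarith
    · have := hle j j' i i' h (by rw [G.edist_comm (u := j')]; rw [← h]; exact m2)
        (by rw [← h]; exact m3)
      linarith
  -- The four possible minimizers give equal sums, by relabelling the nodes and symmetry of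
  -- `nearInd`.
  set Q := ∑ i, ∑ j, ∑ i', ∑ j', A i j * A i' j' * T i j i' j' with hQ
  have q2 : ∑ i, ∑ j, ∑ i', ∑ j', A i j * A i' j' * T j i i' j' = Q := by
    rw [Finset.sum_comm, hQ]
    simp only [hA, nearInd_comm G b]
  have q3 : ∑ i, ∑ j, ∑ i', ∑ j', A i j * A i' j' * T i j j' i' = Q := by
    refine Finset.sum_congr rfl fun i _ => Finset.sum_congr rfl fun j _ => ?_
    rw [Finset.sum_comm]
    simp only [hA, nearInd_comm G b]
  have q4 : ∑ i, ∑ j, ∑ i', ∑ j', A i j * A i' j' * T j i j' i' = Q := by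
    rw [← q3, Finset.sum_comm]
    simp only [hA, nearInd_comm G b]
  have hQle : Q ≤ ∑ i, ∑ j, outerCard G b i j ^ 2 * α (G.edist i j) := by
    -- With `i` and `i'` fixed, the conditions on `j` and `j'` are independent, so the sum
    -- factorizes; `2xy ≤ x² + y²` and symmetry finish.
    have e : Q = ∑ i, ∑ i', α (G.edist i i') * (outerCard G b i i' * outerCard G b i' i) := by
      simp only [outerCard_eq, hQ]
      refine Finset.sum_congr rfl fun i _ => ?_
      rw [Finset.sum_comm]
      refine Finset.sum_congr rfl fun i' _ => ?_
      rw [Finset.sum_mul_sum, Finset.mul_sum]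
      refine Finset.sum_congr rfl fun j _ => ?_
      rw [Finset.mul_sum]
      refine Finset.sum_congr rfl fun j' _ => ?_
      simp only [hT, G.edist_comm (u := i') (v := i)]
      by_cases h1 : G.edist i i' ≤ G.edist i' j <;> by_cases h2 : G.edist i i' ≤ G.edist i j' <;>
        simp [h1, h2, hA]
      ring
    have e2 : ∑ i, ∑ i', α (G.edist i i') * outerCard G b i' i ^ 2
        = ∑ i, ∑ j, outerCard G b i j ^ 2 * α (G.edist i j) := by
      rw [Finset.sum_comm]
      refine Finset.sum_congr rfl fun i _ => Finset.sum_congr rfl fun i' _ => ?_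
      rw [G.edist_comm]; ring
    have : Q ≤ ∑ i, ∑ i', (2⁻¹ * (outerCard G b i i' ^ 2 * α (G.edist i i')) +
        2⁻¹ * (α (G.edist i i') * outerCard G b i' i ^ 2)) := by
      rw [e]
      refine Finset.sum_le_sum fun i _ => Finset.sum_le_sum fun i' _ => ?_
      nlinarith [mul_nonneg (hα (G.edist i i')) (sq_nonneg (outerCard G b i i' - outerCard G b i' i))]
    simp only [Finset.sum_add_distrib, ← Finset.mul_sum] at this
    rw [e2] at this
    linarith
  calc _ ≤ ∑ i, ∑ j, ∑ i', ∑ j', A i j * A i' j' *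
        (T i j i' j' + T j i i' j' + T i j j' i' + T j i j' i') := by
        refine Finset.sum_le_sum fun i _ => Finset.sum_le_sum fun j _ => Finset.sum_le_sum
          fun i' _ => Finset.sum_le_sum fun j' _ => ?_
        exact mul_le_mul_of_nonneg_left (hpt i j i' j')
          (mul_nonneg (nearInd_nonneg G b _ _) (nearInd_nonneg G b _ _))
    _ = Q + Q + Q + Q := by
        simp only [mul_add, Finset.sum_add_distrib]
        rw [q2, q3, q4]
    _ ≤ _ := by linarith

theorem outerCard_self (b : ℝ) (i : Fin n) : outerCard G b i i = ((nbhd G i b).card : ℝ) := by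
  rw [outerCard_eq, ← sum_nearInd]
  simp

theorem nbhdDensity_nonneg (b : ℝ) : 0 ≤ nbhdDensity G b := by
  rw [nbhdDensity]; positivity

theorem nbhdDensity_le (b : ℝ) : nbhdDensity G b ≤ n := by
  have h : ∑ i, ((nbhd G i b).card : ℝ) ≤ ∑ _i : Fin n, (n : ℝ) :=
    Finset.sum_le_sum fun i _ => by
      have := Finset.card_le_univ (nbhd G i b)
      rw [Fintype.card_fin] at this
      exact_mod_cast this
  rw [Finset.sum_const, Finset.card_univ, Fintype.card_fin, nsmul_eq_mul] at h
  rw [nbhdDensity]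
  rcases Nat.eq_zero_or_pos n with h0 | h0
  · simp [h0]
  · rw [inv_mul_le_iff₀ (by exact_mod_cast h0)]
    exact h

/-- Keep only the diagonal `j = i`, at distance 0, where `outerCard` is the full neighborhood size;
then apply Cauchy–Schwarz. This controls the squared error of the sample mean. -/
theorem nbhdDensity_sq_le (b : ℝ) {α : ℕ∞ → ℝ} (hα : ∀ s, 0 ≤ α s) (hα0 : α 0 = 1) :
    nbhdDensity G b ^ 2 ≤ ∑' s : ℕ∞, cStat G s b 2 * α s := by
  refine le_trans ?_ (sum_outerCard_le_tsum_cStat G b hα)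
  have h1 : ∑ i, ((nbhd G i b).card : ℝ) ^ 2
      ≤ ∑ i, ∑ j, outerCard G b i j ^ 2 * α (G.edist i j) := by
    refine Finset.sum_le_sum fun i _ => ?_
    refine le_trans (le_of_eq ?_) (Finset.single_le_sum
      (f := fun j => outerCard G b i j ^ 2 * α (G.edist i j))
      (fun j _ => mul_nonneg (sq_nonneg _) (hα _)) (Finset.mem_univ i))
    simp [outerCard_self, hα0]
  have h2 := sq_sum_le_card_mul_sum_sq (s := Finset.univ) (f := fun i => ((nbhd G i b).card : ℝ))
  rw [Finset.card_univ, Fintype.card_fin] at h2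
  rw [nbhdDensity, mul_pow]
  rcases Nat.eq_zero_or_pos n with h0 | h0
  · subst h0; simp
  · have hn : (0 : ℝ) < n := by exact_mod_cast h0
    calc ((n : ℝ)⁻¹) ^ 2 * (∑ i, ((nbhd G i b).card : ℝ)) ^ 2
        ≤ ((n : ℝ)⁻¹) ^ 2 * (n * ∑ i, ((nbhd G i b).card : ℝ) ^ 2) := by gcongr
      _ = (n : ℝ)⁻¹ * ∑ i, ((nbhd G i b).card : ℝ) ^ 2 := by field_simp
      _ ≤ _ := by gcongr

end Network

/-! ### Kernel weights and clamped coordinates. -/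

section Kernel

theorem toER_nonneg (s : ℕ∞) : 0 ≤ toER s := EReal.coe_ennreal_nonneg _

variable {κ : EReal → ℝ}

theorem IsKernel.abs_weight_le_one (hκ : IsKernel κ) (b : ℝ) (s : ℕ∞) : |weight κ b s| ≤ 1 :=
  abs_le.2 (hκ.mem_Icc _)

theorem IsKernel.weight_eq_zero (hκ : IsKernel κ) {b : ℝ} (hb : 0 < b) {s : ℕ∞} (hs : (b : EReal) < toER s) :
    weight κ b s = 0 := by
  refine hκ.eq_zero _ ?_
  have h1 : (1 : EReal) < toER s / (b : EReal) := by
    rw [EReal.lt_div_iff (by exact_mod_cast hb) (EReal.coe_ne_top b), one_mul]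
    exact hs
  induction h : toER s / (b : EReal) with
  | bot => simp [h] at h1
  | top => simp
  | coe x =>
    rw [h] at h1
    have hx : 1 < x := by exact_mod_cast h1
    rw [EReal.abs_def, ENNReal.one_lt_ofReal]
    exact hx.trans_le (le_abs_self x)

theorem IsKernel.abs_weight_le (hκ : IsKernel κ) {n : ℕ} (G : SimpleGraph (Fin n)) {b : ℝ} (hb : 0 < b)
    (i j : Fin n) : |weight κ b (G.edist i j)| ≤ nearInd G b i j := by
  rw [nearInd]
  split_ifs with h
  · exact hκ.abs_weight_le_one b _
  · rw [hκ.weight_eq_zero hb (not_le.1 h), abs_zero]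

theorem IsKernel.weight_zero (hκ : IsKernel κ) (b : ℝ) : weight κ b 0 = 1 := by
  simp [weight, toER, hκ.at_zero]

theorem IsKernel.measurable_weight (hκ : IsKernel κ) (s : ℕ∞) : Measurable fun b : ℝ => weight κ b s := by
  refine hκ.measurable.comp ?_
  -- Continuity is not available: for `s = ⊤` multiplication by `⊤` jumps at 0. Monotonicity gives
  -- measurability for all `s`.
  have h : Monotone fun x : EReal => toER s * x := fun x y hxy =>
    mul_le_mul_of_nonneg_left hxy (toER_nonneg s)
  have : (fun b : ℝ => toER s / (b : EReal)) = fun b : ℝ => toER s * ((b⁻¹ : ℝ) : EReal) := by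
    funext b
    rw [EReal.coe_inv, EReal.div_eq_inv_mul, mul_comm]
  rw [this]
  exact h.measurable.comp (measurable_coe_real_ereal.comp measurable_inv)

end Kernel

/-- Truncation of a real number at level `c`. -/
def clamp (c : ℕ) (x : ℝ) : ℝ := max (-(c : ℝ)) (min c x)

theorem abs_clamp_le (c : ℕ) (x : ℝ) : |clamp c x| ≤ c := by
  have hc : (0 : ℝ) ≤ c := by positivity
  rw [abs_le, clamp]
  exact ⟨le_max_left _ _, max_le (by linarith) (min_le_left _ _)⟩

theorem abs_clamp_le_abs (c : ℕ) (x : ℝ) : |clamp c x| ≤ |x| := by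
  have hc : (0 : ℝ) ≤ c := by positivity
  rw [abs_le, clamp]
  refine ⟨?_, max_le (by linarith [abs_nonneg x]) ((min_le_right _ _).trans (le_abs_self x))⟩
  refine le_max_of_le_right (le_min ?_ (neg_abs_le x))
  linarith [abs_nonneg x]

theorem clamp_of_abs_le {c : ℕ} {x : ℝ} (h : |x| ≤ c) : clamp c x = x := by
  rw [abs_le] at h
  rw [clamp, min_eq_right h.2, max_eq_right h.1]

theorem abs_clamp_sub_le (c : ℕ) (x y : ℝ) : |clamp c x - clamp c y| ≤ |x - y| := by
  refine (abs_max_sub_max_le_max _ _ _ _).trans ?_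
  rw [sub_self, abs_zero]
  refine max_le (abs_nonneg _) ((abs_min_sub_min_le_max _ _ _ _).trans ?_)
  simp

theorem continuous_clamp (c : ℕ) : Continuous (clamp c) := by
  unfold clamp; fun_prop

/-- The `k`-th coordinate of a vector for `o = some k`, and the constant `1` for `o = none`. -/
def coordOrOne {v : ℕ} (o : Option (Fin v)) (x : EuclideanSpace ℝ (Fin v)) : ℝ :=
  o.elim 1 fun k => x k

theorem continuous_coordOrOne {v : ℕ} (o : Option (Fin v)) : Continuous (coordOrOne o) := by
  cases o with
  | none => exact continuous_const
  | some k => exact EuclideanSpace.proj (𝕜 := ℝ) k |>.continuous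

theorem abs_coordOrOne_le {v : ℕ} (o : Option (Fin v)) (x : EuclideanSpace ℝ (Fin v)) :
    |coordOrOne o x| ≤ max 1 ‖x‖ := by
  cases o with
  | none => simp [coordOrOne]
  | some k => exact le_max_of_le_right (PiLp.norm_apply_le x k)

theorem abs_coordOrOne_sub_le {v : ℕ} (o : Option (Fin v)) (x y : EuclideanSpace ℝ (Fin v)) :
    |coordOrOne o x - coordOrOne o y| ≤ ‖x - y‖ := by
  cases o with
  | none => simp [coordOrOne]
  | some k => exact PiLp.norm_apply_le (x - y) k

/-! ### Covariance inequalities under one frozen law. -/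

section FixedSize

open ProbabilityTheory

variable {n v : ℕ}

theorem continuous_coordOrOne_eval (o : Option (Fin v)) (i : Fin n) :
    Continuous fun y : Fin n → EuclideanSpace ℝ (Fin v) => coordOrOne o (y i) :=
  (continuous_coordOrOne o).comp (continuous_apply i)

/-- Product of coordinates at two nodes. -/
def nodeProd (o o' : Option (Fin v)) (i j : Fin n) (y : Fin n → EuclideanSpace ℝ (Fin v)) : ℝ :=
  coordOrOne o (y i) * coordOrOne o' (y j)

/-- Product of truncated coordinates at two nodes. -/
def truncNodeProd (c : ℕ) (o o' : Option (Fin v)) (i j : Fin n)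
    (y : Fin n → EuclideanSpace ℝ (Fin v)) : ℝ :=
  clamp c (coordOrOne o (y i)) * clamp c (coordOrOne o' (y j))

theorem measurable_nodeProd (o o' : Option (Fin v)) (i j : Fin n) :
    Measurable (nodeProd o o' i j) :=
  ((continuous_coordOrOne_eval o i).mul (continuous_coordOrOne_eval o' j)).measurable

theorem measurable_truncNodeProd (c : ℕ) (o o' : Option (Fin v)) (i j : Fin n) :
    Measurable (truncNodeProd c o o' i j) :=
  (((continuous_clamp c).comp (continuous_coordOrOne_eval o i)).mul
    ((continuous_clamp c).comp (continuous_coordOrOne_eval o' j))).measurable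

/-- Uniform `p`-th moments, and covariance inequalities for truncated coordinates and products of
truncated coordinates. -/
structure HasTruncCov (P : Measure (Fin n → EuclideanSpace ℝ (Fin v))) (G : SimpleGraph (Fin n))
    (θ : ℕ∞ → ℝ) (p R K : ℝ) : Prop where
  integrable : ∀ i, Integrable (fun y => ‖y i‖ ^ p) P
  integral_le : ∀ i, ∫ y, ‖y i‖ ^ p ∂P ≤ R
  coeff_nonneg : ∀ s, 0 ≤ θ s
  coeff_zero : θ 0 = 1
  single : ∀ (c : ℕ), 1 ≤ c → ∀ (o o' : Option (Fin v)) (i j : Fin n), 0 < G.edist i j →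
    |cov[fun y => clamp c (coordOrOne o (y i)), fun y => clamp c (coordOrOne o' (y j)); P]|
      ≤ K * c ^ (1 + 1) * θ (G.edist i j)
  pair : ∀ (c : ℕ), 1 ≤ c → ∀ (o₁ o₂ o₃ o₄ : Option (Fin v)) (i j i' j' : Fin n),
    0 < pairDist G i j i' j' →
    |cov[truncNodeProd c o₁ o₂ i j, truncNodeProd c o₃ o₄ i' j'; P]|
      ≤ K * c ^ (2 + 2) * θ (pairDist G i j i' j')

variable {P : Measure (Fin n → EuclideanSpace ℝ (Fin v))} {G : SimpleGraph (Fin n)}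
  {θ : ℕ∞ → ℝ} {p R K : ℝ}

/-- Envelope of the norms at four nodes. -/
def normEnvelope (i j i' j' : Fin n) (y : Fin n → EuclideanSpace ℝ (Fin v)) : ℝ :=
  max 1 (max (max ‖y i‖ ‖y j‖) (max ‖y i'‖ ‖y j'‖))

/-- The `p`-th power of a maximum is at most the sum of the `p`-th powers: the constant 1 and four
norms. -/
theorem HasTruncCov.isEnvelope [IsProbabilityMeasure P] (h : HasTruncCov P G θ p R K)
    (i j i' j' : Fin n) :
    IsEnvelope P p (1 + 4 * R) (normEnvelope i j i' j') := by
  have hmeas : Measurable (normEnvelope (v := v) i j i' j') := by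
    unfold normEnvelope
    exact Continuous.measurable (by fun_prop)
  have hle : ∀ y : Fin n → EuclideanSpace ℝ (Fin v), normEnvelope i j i' j' y ^ p
      ≤ 1 + (‖y i‖ ^ p + ‖y j‖ ^ p + ‖y i'‖ ^ p + ‖y j'‖ ^ p) := by
    intro y
    have hmax : ∀ {a b : ℝ}, 0 ≤ a → 0 ≤ b → (max a b) ^ p ≤ a ^ p + b ^ p := by
      intro a b ha hb
      have h1 := Real.rpow_nonneg ha p
      have h2 := Real.rpow_nonneg hb p
      rcases max_choice a b with h | h <;> rw [h] <;> linarith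
    have h1 := hmax (norm_nonneg (y i)) (norm_nonneg (y j))
    have h2 := hmax (norm_nonneg (y i')) (norm_nonneg (y j'))
    have h3 := hmax (a := max ‖y i‖ ‖y j‖) (b := max ‖y i'‖ ‖y j'‖) (by positivity) (by positivity)
    have h4 := hmax (a := 1) (b := max (max ‖y i‖ ‖y j‖) (max ‖y i'‖ ‖y j'‖))
      (by positivity) (by positivity)
    rw [Real.one_rpow] at h4
    unfold normEnvelope
    linarith
  have hint : Integrable (fun y : Fin n → EuclideanSpace ℝ (Fin v) =>
      1 + (‖y i‖ ^ p + ‖y j‖ ^ p + ‖y i'‖ ^ p + ‖y j'‖ ^ p)) P :=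
    (integrable_const 1).add
      ((((h.integrable i).add (h.integrable j)).add (h.integrable i')).add (h.integrable j'))
  refine ⟨hmeas, fun y => le_max_left _ _, ?_, ?_⟩
  · refine hint.mono' (hmeas.pow_const p).aestronglyMeasurable (ae_of_all _ fun y => ?_)
    have : 0 ≤ normEnvelope i j i' j' y := zero_le_one.trans (le_max_left _ _)
    rw [Real.norm_of_nonneg (Real.rpow_nonneg this _)]
    exact hle y
  · have hi := h.integrable
    refine (integral_mono_of_nonneg (ae_of_all _ fun y => Real.rpow_nonneg
      (zero_le_one.trans (le_max_left _ _)) _) hint (ae_of_all _ hle)).trans ?_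
    have h2 : Integrable (fun y => ‖y i‖ ^ p + ‖y j‖ ^ p) P := (hi i).add (hi j)
    have h3 : Integrable (fun y => ‖y i‖ ^ p + ‖y j‖ ^ p + ‖y i'‖ ^ p) P := h2.add (hi i')
    have h4 : Integrable (fun y => ‖y i‖ ^ p + ‖y j‖ ^ p + ‖y i'‖ ^ p + ‖y j'‖ ^ p) P :=
      h3.add (hi j')
    rw [integral_add (integrable_const 1) h4, integral_add h3 (hi j'),
      integral_add h2 (hi i'), integral_add (hi i) (hi j)]
    simp only [integral_const, probReal_univ, smul_eq_mul, mul_one]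
    linarith [h.integral_le i, h.integral_le j, h.integral_le i', h.integral_le j']

theorem abs_coordOrOne_le_normEnvelope (o : Option (Fin v)) (i j i' j' : Fin n)
    (y : Fin n → EuclideanSpace ℝ (Fin v)) :
    |coordOrOne o (y i)| ≤ normEnvelope i j i' j' y ∧
    |coordOrOne o (y j)| ≤ normEnvelope i j i' j' y ∧
    |coordOrOne o (y i')| ≤ normEnvelope i j i' j' y ∧
    |coordOrOne o (y j')| ≤ normEnvelope i j i' j' y := by
  refine ⟨?_, ?_, ?_, ?_⟩ <;>
  · refine (abs_coordOrOne_le _ _).trans ?_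
    unfold normEnvelope
    refine max_le_max le_rfl ?_
    simp

/-- Constant of the covariance inequalities. -/
def covConst (R K : ℝ) : ℝ := 16 * K + 8 * (1 + 4 * R) ^ 2

theorem covConst_nonneg (hK : 0 ≤ K) : 0 ≤ covConst R K := by
  unfold covConst; positivity

theorem HasTruncCov.memLp_coordOrOne [IsProbabilityMeasure P] (h : HasTruncCov P G θ p R K)
    (hp : 4 < p) (o : Option (Fin v)) (i : Fin n) :
    MemLp (fun y => coordOrOne o (y i)) 2 P :=
  (h.isEnvelope i i i i).memLp_two (r := 1) (by norm_num; linarith)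
    (continuous_coordOrOne_eval o i).measurable
    fun y => by rw [pow_one]; exact (abs_coordOrOne_le_normEnvelope o i i i i y).1

theorem abs_nodeProd_le_normEnvelope (o o' : Option (Fin v)) (i j i' j' : Fin n)
    (y : Fin n → EuclideanSpace ℝ (Fin v)) :
    |nodeProd o o' i j y| ≤ normEnvelope i j i' j' y ^ 2 ∧
    |nodeProd o o' i' j' y| ≤ normEnvelope i j i' j' y ^ 2 := by
  have h1 := abs_coordOrOne_le_normEnvelope o i j i' j' y
  have h2 := abs_coordOrOne_le_normEnvelope o' i j i' j' y
  have h0 : 0 ≤ normEnvelope i j i' j' y := zero_le_one.trans (le_max_left _ _)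
  rw [sq, nodeProd, nodeProd, abs_mul, abs_mul]
  exact ⟨mul_le_mul h1.1 h2.2.1 (abs_nonneg _) h0,
    mul_le_mul h1.2.2.1 h2.2.2.2 (abs_nonneg _) h0⟩

theorem abs_truncNodeProd_le (c : ℕ) (o o' : Option (Fin v)) (i j : Fin n)
    (y : Fin n → EuclideanSpace ℝ (Fin v)) :
    |truncNodeProd c o o' i j y| ≤ |nodeProd o o' i j y| := by
  rw [truncNodeProd, nodeProd, abs_mul, abs_mul]
  exact mul_le_mul (abs_clamp_le_abs _ _) (abs_clamp_le_abs _ _) (abs_nonneg _) (abs_nonneg _)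

theorem HasTruncCov.memLp_nodeProd [IsProbabilityMeasure P] (h : HasTruncCov P G θ p R K)
    (hp : 4 < p) (o o' : Option (Fin v)) (i j : Fin n) : MemLp (nodeProd o o' i j) 2 P :=
  (h.isEnvelope i j i j).memLp_two (r := 2) (by norm_num; linarith)
    (measurable_nodeProd o o' i j) fun y => (abs_nodeProd_le_normEnvelope o o' i j i j y).1

theorem HasTruncCov.abs_integral_coordOrOne_le [IsProbabilityMeasure P]
    (h : HasTruncCov P G θ p R K) (hp : 4 < p) (o : Option (Fin v)) (i : Fin n) :
    |∫ y, coordOrOne o (y i) ∂P| ≤ 1 + 4 * R :=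
  abs_integral_le_integral_abs.trans
    ((h.isEnvelope i i i i).integral_abs_le (r := 1) (by norm_num; linarith)
      fun y => by rw [pow_one]; exact (abs_coordOrOne_le_normEnvelope o i i i i y).1)

theorem HasTruncCov.abs_cov_coord_le_const [IsProbabilityMeasure P]
    (h : HasTruncCov P G θ p R K) (hp : 4 < p) (hK : 0 ≤ K) (o o' : Option (Fin v))
    (i j : Fin n) :
    |cov[fun y => coordOrOne o (y i), fun y => coordOrOne o' (y j); P]| ≤ covConst R K := by
  refine ((h.isEnvelope i j i j).abs_cov_le (r := 1) (by norm_num; linarith)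
    (continuous_coordOrOne_eval o i).measurable (continuous_coordOrOne_eval o' j).measurable
    (fun y => by rw [pow_one]; exact (abs_coordOrOne_le_normEnvelope o i j i j y).1)
    (fun y => by rw [pow_one]; exact (abs_coordOrOne_le_normEnvelope o' i j i j y).2.1)).trans ?_
  unfold covConst
  nlinarith [sq_nonneg (1 + 4 * R)]

/-- Truncation with `r = 1`: a coordinate grows like the envelope itself. -/
theorem HasTruncCov.abs_cov_coord_le [IsProbabilityMeasure P]
    (h : HasTruncCov P G θ p R K) (hp : 4 < p) (hK : 0 ≤ K) (o o' : Option (Fin v))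
    {i j : Fin n} (hij : 0 < G.edist i j) :
    |cov[fun y => coordOrOne o (y i), fun y => coordOrOne o' (y j); P]|
      ≤ covConst R K * θ (G.edist i j) ^ (1 - 2 / p) := by
  have hE := h.isEnvelope i j i j
  have := hE.abs_cov_le_of_trunc (r := 1)
    (F := fun y => coordOrOne o (y i)) (H := fun y => coordOrOne o' (y j))
    (Fc := fun c y => clamp c (coordOrOne o (y i)))
    (Hc := fun c y => clamp c (coordOrOne o' (y j))) (by norm_num; linarith)
    (continuous_coordOrOne_eval o i).measurable (continuous_coordOrOne_eval o' j).measurable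
    (fun c => ((continuous_clamp c).comp (continuous_coordOrOne_eval o i)).measurable)
    (fun c => ((continuous_clamp c).comp (continuous_coordOrOne_eval o' j)).measurable)
    (fun y => by rw [pow_one]; exact (abs_coordOrOne_le_normEnvelope o i j i j y).1)
    (fun y => by rw [pow_one]; exact (abs_coordOrOne_le_normEnvelope o' i j i j y).2.1)
    (fun c y => by
      rw [pow_one]
      exact (abs_clamp_le_abs _ _).trans (abs_coordOrOne_le_normEnvelope o i j i j y).1)
    (fun c y => by
      rw [pow_one]
      exact (abs_clamp_le_abs _ _).trans (abs_coordOrOne_le_normEnvelope o' i j i j y).2.1)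
    (fun c y hy => clamp_of_abs_le ((abs_coordOrOne_le_normEnvelope o i j i j y).1.trans hy))
    (fun c y hy => clamp_of_abs_le ((abs_coordOrOne_le_normEnvelope o' i j i j y).2.1.trans hy))
    hK (h.coeff_nonneg _) (fun c hc => h.single c hc o o' i j hij)
  norm_num at this
  refine this.trans (mul_le_mul_of_nonneg_right ?_ (Real.rpow_nonneg (h.coeff_nonneg _) _))
  unfold covConst
  linarith

/-- Truncation with `r = 2`, which needs `4 < p`. The constant is `K * 2 ^ (2 + 2)` plus the moment
term with bound `1 + 4 * R`. -/
theorem HasTruncCov.abs_cov_nodeProd_le [IsProbabilityMeasure P]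
    (h : HasTruncCov P G θ p R K) (hp : 4 < p) (hK : 0 ≤ K) (o₁ o₂ o₃ o₄ : Option (Fin v))
    (i j i' j' : Fin n) :
    |cov[nodeProd o₁ o₂ i j, nodeProd o₃ o₄ i' j'; P]|
      ≤ covConst R K * θ (pairDist G i j i' j') ^ (1 - 4 / p) := by
  have hE := h.isEnvelope i j i' j'
  rcases eq_or_ne (pairDist G i j i' j') 0 with h0 | h0
  -- Pairs sharing a node are outside the dependence assumption; as `θ 0 = 1`, the moment bound
  -- already has the required form.
  · rw [h0, h.coeff_zero, Real.one_rpow, mul_one]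
    refine (hE.abs_cov_le (r := 2) (by norm_num; linarith)
      (measurable_nodeProd _ _ _ _) (measurable_nodeProd _ _ _ _)
      (fun y => (abs_nodeProd_le_normEnvelope o₁ o₂ i j i' j' y).1)
      (fun y => (abs_nodeProd_le_normEnvelope o₃ o₄ i j i' j' y).2)).trans ?_
    unfold covConst
    nlinarith [sq_nonneg (1 + 4 * R)]
  · have hle : ∀ {a b : ℝ} {c : ℕ}, |a| ≤ c → |b| ≤ c → clamp c a * clamp c b = a * b :=
      fun ha hb => by rw [clamp_of_abs_le ha, clamp_of_abs_le hb]
    have := hE.abs_cov_le_of_trunc (r := 2)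
      (F := nodeProd o₁ o₂ i j) (H := nodeProd o₃ o₄ i' j')
      (Fc := fun c => truncNodeProd c o₁ o₂ i j) (Hc := fun c => truncNodeProd c o₃ o₄ i' j')
      (by norm_num; linarith)
      (measurable_nodeProd _ _ _ _) (measurable_nodeProd _ _ _ _)
      (fun c => measurable_truncNodeProd _ _ _ _ _) (fun c => measurable_truncNodeProd _ _ _ _ _)
      (fun y => (abs_nodeProd_le_normEnvelope o₁ o₂ i j i' j' y).1)
      (fun y => (abs_nodeProd_le_normEnvelope o₃ o₄ i j i' j' y).2)
      (fun c y => (abs_truncNodeProd_le _ _ _ _ _ _).trans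
        (abs_nodeProd_le_normEnvelope o₁ o₂ i j i' j' y).1)
      (fun c y => (abs_truncNodeProd_le _ _ _ _ _ _).trans
        (abs_nodeProd_le_normEnvelope o₃ o₄ i j i' j' y).2)
      (fun c y hy => hle ((abs_coordOrOne_le_normEnvelope o₁ i j i' j' y).1.trans hy)
        ((abs_coordOrOne_le_normEnvelope o₂ i j i' j' y).2.1.trans hy))
      (fun c y hy => hle ((abs_coordOrOne_le_normEnvelope o₃ i j i' j' y).2.2.1.trans hy)
        ((abs_coordOrOne_le_normEnvelope o₄ i j i' j' y).2.2.2.trans hy))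
      hK (h.coeff_nonneg _) (fun c hc => h.pair c hc o₁ o₂ o₃ o₄ i j i' j' (pos_iff_ne_zero.2 h0))
    norm_num at this
    refine this.trans (mul_le_mul_of_nonneg_right ?_ (Real.rpow_nonneg (h.coeff_nonneg _) _))
    unfold covConst
    linarith

end FixedSize

/-! ### Variance and bias of the weighted sums. -/

section FixedSizeStatistics

open ProbabilityTheory

theorem integral_abs_mul_abs_le_sqrt {S : Type*} [MeasurableSpace S] {P : Measure S}
    {X Z : S → ℝ} (hX : MemLp X 2 P) (hZ : MemLp Z 2 P) :
    ∫ y, |X y| * |Z y| ∂P ≤ √(∫ y, X y ^ 2 ∂P) * √(∫ y, Z y ^ 2 ∂P) := by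
  have h := integral_mul_le_Lp_mul_Lq_of_nonneg (μ := P) (p := 2) (q := 2)
    (by rw [Real.holderConjugate_iff]; norm_num) (f := fun y => |X y|) (g := fun y => |Z y|)
    (ae_of_all _ fun y => abs_nonneg _) (ae_of_all _ fun y => abs_nonneg _)
    (by rw [ENNReal.ofReal_ofNat]; exact hX.norm) (by rw [ENNReal.ofReal_ofNat]; exact hZ.norm)
  simpa [Real.sqrt_eq_rpow] using h

theorem covariance_self_eq_integral {S : Type*} [MeasurableSpace S] {P : Measure S}
    (X : S → ℝ) : cov[X, X; P] = ∫ y, (X y - ∫ z, X z ∂P) ^ 2 ∂P := by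
  rw [covariance]
  simp only [sq]

variable {n v : ℕ}

/-- Weighted average of products of coordinates over pairs of nodes. -/
def hacForm (κ : EReal → ℝ) (b : ℝ) (G : SimpleGraph (Fin n)) (o o' : Option (Fin v))
    (y : Fin n → EuclideanSpace ℝ (Fin v)) : ℝ :=
  (n : ℝ)⁻¹ * ∑ i, ∑ j, weight κ b (G.edist i j) * nodeProd o o' i j y

variable {P : Measure (Fin n → EuclideanSpace ℝ (Fin v))}
  {G : SimpleGraph (Fin n)} {θ : ℕ∞ → ℝ} {p R K b : ℝ} {κ : EReal → ℝ}

/-- The normalized bandwidth statistic. -/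
def bandStat (G : SimpleGraph (Fin n)) (b p : ℝ) (θ : ℕ∞ → ℝ) : ℝ :=
  (n : ℝ)⁻¹ * ∑' s : ℕ∞, cStat G s b 2 * θ s ^ (1 - 4 / p)

/-- The statistic controlling the bias due to the kernel weights. -/
def biasStat (κ : EReal → ℝ) (G : SimpleGraph (Fin n)) (b p : ℝ) (θ : ℕ∞ → ℝ) : ℝ :=
  ∑' s : ℕ∞, if 1 ≤ s then
    |weight κ b s - 1| * shellDensity G s 1 * θ s ^ (1 - 2 / p) else 0

theorem HasTruncCov.memLp_hacForm [IsProbabilityMeasure P] (h : HasTruncCov P G θ p R K) (hp : 4 < p)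
    (o o' : Option (Fin v)) : MemLp (hacForm κ b G o o') 2 P := by
  unfold hacForm
  have h1 : ∀ i, MemLp (fun y => ∑ j, weight κ b (G.edist i j) * nodeProd o o' i j y) 2 P :=
    fun i => memLp_finsetSum _ fun j _ => (h.memLp_nodeProd hp o o' i j).const_mul _
  have h2 : MemLp (fun y => ∑ i, ∑ j, weight κ b (G.edist i j) * nodeProd o o' i j y) 2 P :=
    memLp_finsetSum _ fun i _ => h1 i
  exact h2.const_mul _

theorem HasTruncCov.integral_hacForm [IsProbabilityMeasure P] (h : HasTruncCov P G θ p R K) (hp : 4 < p)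
    (o o' : Option (Fin v)) :
    ∫ y, hacForm κ b G o o' y ∂P
      = (n : ℝ)⁻¹ * ∑ i, ∑ j, weight κ b (G.edist i j) * ∫ y, nodeProd o o' i j y ∂P := by
  have hi : ∀ i j, Integrable (fun y => weight κ b (G.edist i j) * nodeProd o o' i j y) P :=
    fun i j => ((h.memLp_nodeProd hp o o' i j).integrable one_le_two).const_mul _
  unfold hacForm
  rw [integral_const_mul, integral_finsetSum _ fun i _ => integrable_finsetSum _ fun j _ => hi i j]
  congr 1
  refine Finset.sum_congr rfl fun i _ => ?_
  rw [integral_finsetSum _ fun j _ => hi i j]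
  exact Finset.sum_congr rfl fun j _ => integral_const_mul _ _

/-- Weights are at most 1 in absolute value and vanish beyond the bandwidth, so only near pairs
enter; the covariance inequality and the pair count give the rest. The choice `none` in one slot
covers one-sided weighted sums as well. -/
theorem HasTruncCov.cov_hacForm_le [IsProbabilityMeasure P] (h : HasTruncCov P G θ p R K) (hp : 4 < p) (hK : 0 ≤ K)
    (hκ : IsKernel κ) (hb : 0 < b) (o o' : Option (Fin v)) :
    cov[hacForm κ b G o o', hacForm κ b G o o'; P] ≤ 4 * covConst R K * bandStat G b p θ := by
  have hcC : 0 ≤ covConst R K := covConst_nonneg hK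
  set α : ℕ∞ → ℝ := fun s => θ s ^ (1 - 4 / p) with hα
  have hα0 : ∀ s, 0 ≤ α s := fun s => Real.rpow_nonneg (h.coeff_nonneg s) _
  have e : hacForm κ b G o o' = fun y => (n : ℝ)⁻¹ * ∑ q : Fin n × Fin n,
      weight κ b (G.edist q.1 q.2) * nodeProd o o' q.1 q.2 y := by
    funext y
    rw [hacForm, Fintype.sum_prod_type]
  have hm : ∀ q : Fin n × Fin n, MemLp (fun y => weight κ b (G.edist q.1 q.2) *
      nodeProd o o' q.1 q.2 y) 2 P := fun q => (h.memLp_nodeProd hp o o' q.1 q.2).const_mul _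
  rw [e, covariance_const_mul_left, covariance_const_mul_right, covariance_fun_sum_fun_sum hm hm]
  simp only [covariance_const_mul_left, covariance_const_mul_right, Fintype.sum_prod_type]
  have h1 : ∑ i, ∑ j, ∑ i', ∑ j', weight κ b (G.edist i' j') * (weight κ b (G.edist i j) *
      cov[nodeProd o o' i j, nodeProd o o' i' j'; P]) ≤ covConst R K *
      ∑ i, ∑ j, ∑ i', ∑ j', nearInd G b i j * nearInd G b i' j' * α (pairDist G i j i' j') := by
    simp only [Finset.mul_sum]
    refine Finset.sum_le_sum fun i _ => Finset.sum_le_sum fun j _ => Finset.sum_le_sum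
      fun i' _ => Finset.sum_le_sum fun j' _ => (le_abs_self _).trans ?_
    rw [abs_mul, abs_mul]
    calc _ ≤ nearInd G b i' j' * (nearInd G b i j *
          (covConst R K * α (pairDist G i j i' j'))) := by
          refine mul_le_mul (hκ.abs_weight_le G hb i' j') ?_ (by positivity) (nearInd_nonneg G b _ _)
          exact mul_le_mul (hκ.abs_weight_le G hb i j)
            (h.abs_cov_nodeProd_le hp hK o o' o o' i j i' j') (abs_nonneg _)
            (nearInd_nonneg G b _ _)
      _ = _ := by ring
  have h2 := sum_pairDist_le G b hα0
  have h3 := sum_outerCard_le_tsum_cStat G b hα0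
  have hn : (0 : ℝ) ≤ (n : ℝ)⁻¹ := by positivity
  calc _ ≤ (n : ℝ)⁻¹ * ((n : ℝ)⁻¹ * (covConst R K *
        (4 * ∑ i, ∑ j, outerCard G b i j ^ 2 * α (G.edist i j)))) := by
        refine mul_le_mul_of_nonneg_left (mul_le_mul_of_nonneg_left ?_ hn) hn
        exact h1.trans (mul_le_mul_of_nonneg_left h2 hcC)
    _ = 4 * covConst R K * ((n : ℝ)⁻¹ *
        ((n : ℝ)⁻¹ * ∑ i, ∑ j, outerCard G b i j ^ 2 * α (G.edist i j))) := by ring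
    _ ≤ _ := by
        unfold bandStat
        gcongr

theorem HasTruncCov.biasStat_nonneg (h : HasTruncCov P G θ p R K) : 0 ≤ biasStat κ G b p θ := by
  refine tsum_nonneg fun s => ?_
  split_ifs
  · have := h.coeff_nonneg s
    rw [sum_shell_density]
    positivity
  · exact le_rfl

theorem HasTruncCov.nbhdDensity_sq_div_le (h : HasTruncCov P G θ p R K) :
    (n : ℝ)⁻¹ * nbhdDensity G b ^ 2 ≤ bandStat G b p θ := by
  unfold bandStat
  gcongr
  exact nbhdDensity_sq_le G b (fun s => Real.rpow_nonneg (h.coeff_nonneg s) _)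
    (by rw [h.coeff_zero, Real.one_rpow])

theorem HasTruncCov.bandStat_nonneg (h : HasTruncCov P G θ p R K) : 0 ≤ bandStat G b p θ :=
  le_trans (by positivity) (h.nbhdDensity_sq_div_le (b := b))

/-- Entry of the long-run variance of a fixed-size sample. -/
def longRunCov (P : Measure (Fin n → EuclideanSpace ℝ (Fin v))) (k l : Option (Fin v)) : ℝ :=
  (n : ℝ)⁻¹ * ∑ i, ∑ j, cov[fun y => coordOrOne k (y i), fun y => coordOrOne l (y j); P]

/-- The diagonal contributes no bias since the weight at distance 0 is 1; elsewhere the covariance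
decay applies. -/
theorem HasTruncCov.abs_bias_le [IsProbabilityMeasure P] (h : HasTruncCov P G θ p R K) (hp : 4 < p) (hK : 0 ≤ K)
    (hκ : IsKernel κ) (k l : Option (Fin v)) :
    |(n : ℝ)⁻¹ * (∑ i, ∑ j, weight κ b (G.edist i j) *
        cov[fun y => coordOrOne k (y i), fun y => coordOrOne l (y j); P]) - longRunCov P k l|
      ≤ covConst R K * biasStat κ G b p θ := by
  have hn : (0 : ℝ) ≤ (n : ℝ)⁻¹ := by positivity
  rw [biasStat, tsum_weight_eq, longRunCov, ← mul_sub, ← Finset.sum_sub_distrib, abs_mul,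
    abs_of_nonneg hn, mul_left_comm]
  refine mul_le_mul_of_nonneg_left ?_ hn
  rw [Finset.mul_sum]
  refine (Finset.abs_sum_le_sum_abs _ _).trans (Finset.sum_le_sum fun i _ => ?_)
  rw [← Finset.sum_sub_distrib, Finset.mul_sum]
  refine (Finset.abs_sum_le_sum_abs _ _).trans (Finset.sum_le_sum fun j _ => ?_)
  rw [← sub_one_mul, abs_mul]
  split_ifs with hij
  · have := h.abs_cov_coord_le hp hK k l (i := i) (j := j) (zero_lt_one.trans_le hij)
    calc _ ≤ |weight κ b (G.edist i j) - 1| *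
          (covConst R K * θ (G.edist i j) ^ (1 - 2 / p)) := by gcongr
      _ = _ := by ring
  · have : G.edist i j = 0 := by rwa [Order.one_le_iff_ne_zero, not_not] at hij
    rw [this, hκ.weight_zero]
    simp

/-- Within the bandwidth a constant is enough. Beyond it the weight is 0, so `|weight - 1| = 1` and
the bias term is exactly the covariance bound. -/
theorem HasTruncCov.abs_cov_coord_le_split [IsProbabilityMeasure P] (h : HasTruncCov P G θ p R K) (hp : 4 < p)
    (hK : 0 ≤ K) (hκ : IsKernel κ) (hb : 0 < b) (k l : Option (Fin v)) (i j : Fin n) :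
    |cov[fun y => coordOrOne k (y i), fun y => coordOrOne l (y j); P]|
      ≤ covConst R K * (nearInd G b i j + if 1 ≤ G.edist i j then
          |weight κ b (G.edist i j) - 1| * θ (G.edist i j) ^ (1 - 2 / p) else 0) := by
  have hc := covConst_nonneg (R := R) hK
  have hθ := Real.rpow_nonneg (h.coeff_nonneg (G.edist i j)) (1 - 2 / p)
  by_cases hnear : toER (G.edist i j) ≤ (b : EReal)
  · refine (h.abs_cov_coord_le_const hp hK k l i j).trans ?_
    rw [nearInd, if_pos hnear]
    refine le_mul_of_one_le_right hc (le_add_of_nonneg_right ?_)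
    split_ifs <;> positivity
  · have h1 : 1 ≤ G.edist i j := by
      rw [Order.one_le_iff_ne_zero]
      intro h0
      refine hnear ?_
      rw [h0]
      simpa [toER] using hb.le
    rw [nearInd, if_neg hnear, if_pos h1, hκ.weight_eq_zero hb (not_le.1 hnear)]
    simpa using h.abs_cov_coord_le hp hK k l (zero_lt_one.trans_le h1)

/-- Centered coordinate of the sample mean. -/
def centeredMean (Λ : EuclideanSpace ℝ (Fin v)) (k : Fin v)
    (y : Fin n → EuclideanSpace ℝ (Fin v)) : ℝ :=
  (n : ℝ)⁻¹ * ∑ i, (y i k - Λ k)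

theorem HasTruncCov.memLp_centeredMean [IsProbabilityMeasure P] (h : HasTruncCov P G θ p R K) (hp : 4 < p)
    (Λ : EuclideanSpace ℝ (Fin v)) (k : Fin v) : MemLp (centeredMean (n := n) Λ k) 2 P := by
  unfold centeredMean
  have h1 : MemLp (fun y : Fin n → EuclideanSpace ℝ (Fin v) => ∑ i, (y i k - Λ k)) 2 P :=
    memLp_finsetSum _ fun i _ => (h.memLp_coordOrOne hp (some k) i).sub (memLp_const _)
  exact h1.const_mul _

theorem HasTruncCov.integral_centeredMean_sq [IsProbabilityMeasure P] (h : HasTruncCov P G θ p R K) (hp : 4 < p)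
    {Λ : EuclideanSpace ℝ (Fin v)} (hΛ : ∀ i k, ∫ y, y i k ∂P = Λ k) (k : Fin v) :
    ∫ y, centeredMean Λ k y ^ 2 ∂P = (n : ℝ)⁻¹ * longRunCov P (some k) (some k) := by
  have hm : ∀ i : Fin n, MemLp (fun y : Fin n → EuclideanSpace ℝ (Fin v) => y i k - Λ k) 2 P :=
    fun i => (h.memLp_coordOrOne hp (some k) i).sub (memLp_const _)
  have hint : ∀ i : Fin n, Integrable (fun y : Fin n → EuclideanSpace ℝ (Fin v) => y i k) P :=
    fun i => (h.memLp_coordOrOne hp (some k) i).integrable one_le_two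
  have hmean : ∫ y, centeredMean (n := n) Λ k y ∂P = 0 := by
    unfold centeredMean
    rw [integral_const_mul, integral_finsetSum _ fun i _ => (hm i).integrable one_le_two]
    simp [integral_sub (hint _) (integrable_const _), hΛ]
  have e := covariance_self_eq_integral (P := P) (centeredMean (n := n) Λ k)
  simp only [hmean, sub_zero] at e
  rw [← e]
  unfold centeredMean
  rw [covariance_const_mul_left, covariance_const_mul_right, covariance_fun_sum_fun_sum hm hm,
    longRunCov]
  congr 2
  refine Finset.sum_congr rfl fun i _ => Finset.sum_congr rfl fun j _ => ?_
  rw [covariance_sub_const_left (hint i), covariance_sub_const_right (hint j)]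
  rfl

/-- The long-run variance need not stay bounded; growth no faster than δ + η is enough, since it
enters the demeaned estimator with the factor δ/n. -/
theorem HasTruncCov.longRunCov_le [IsProbabilityMeasure P] (h : HasTruncCov P G θ p R K) (hp : 4 < p)
    (hK : 0 ≤ K) (hκ : IsKernel κ) (hb : 0 < b) (k l : Option (Fin v)) :
    longRunCov P k l ≤ covConst R K * (nbhdDensity G b + biasStat κ G b p θ) := by
  rw [biasStat, tsum_weight_eq, nbhdDensity_eq, ← mul_add, longRunCov, mul_left_comm,
    ← Finset.sum_add_distrib]
  refine mul_le_mul_of_nonneg_left ?_ (by positivity)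
  rw [Finset.mul_sum]
  refine Finset.sum_le_sum fun i _ => ?_
  rw [← Finset.sum_add_distrib, Finset.mul_sum]
  exact Finset.sum_le_sum fun j _ =>
    (le_abs_self _).trans (h.abs_cov_coord_le_split hp hK hκ hb k l i j)

/-- A bound on the second moment of the centered mean, used where the other factor is already small.
-/
theorem HasTruncCov.longRunCov_le_card [IsProbabilityMeasure P] (h : HasTruncCov P G θ p R K) (hp : 4 < p)
    (hK : 0 ≤ K) (k l : Option (Fin v)) :
    (n : ℝ)⁻¹ * longRunCov P k l ≤ covConst R K := by
  have hc := covConst_nonneg (R := R) hK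
  have h1 : ∑ i : Fin n, ∑ j : Fin n,
      cov[fun y => coordOrOne k (y i), fun y => coordOrOne l (y j); P]
        ≤ ∑ _i : Fin n, ∑ _j : Fin n, covConst R K :=
    Finset.sum_le_sum fun i _ => Finset.sum_le_sum fun j _ =>
      (le_abs_self _).trans (h.abs_cov_coord_le_const hp hK k l i j)
  simp only [Finset.sum_const, Finset.card_univ, Fintype.card_fin, nsmul_eq_mul] at h1
  rw [longRunCov]
  rcases Nat.eq_zero_or_pos n with h0 | h0
  · subst h0; simpa using hc
  · have hn : (0 : ℝ) < n := by exact_mod_cast h0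
    rw [inv_mul_le_iff₀ hn, inv_mul_le_iff₀ hn]
    exact h1

end FixedSizeStatistics

/-! ### From matrix entries to the Frobenius norm. -/

section FrobeniusNorm

variable {v : ℕ}

theorem frob_eq (A : Matrix (Fin v) (Fin v) ℝ) : frob A = √(∑ k, ∑ l, A k l ^ 2) := by
  rw [frob]
  congr 1
  simp only [Matrix.trace, Matrix.diag_apply, Matrix.mul_apply, Matrix.transpose_apply, sq]
  exact Finset.sum_comm

theorem frob_le_sum_abs (A : Matrix (Fin v) (Fin v) ℝ) : frob A ≤ ∑ k, ∑ l, |A k l| := by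
  rw [frob_eq, ← Fintype.sum_prod_type', ← Fintype.sum_prod_type']
  refine Real.sqrt_le_iff.2 ⟨Finset.sum_nonneg fun q _ => abs_nonneg _, ?_⟩
  refine le_trans (le_of_eq ?_) (Finset.sum_sq_le_sq_sum_of_nonneg fun q _ => abs_nonneg _)
  simp

/-- Integrable majorants of the entries suffice, so nothing is asked about the measurability of `M`.
-/
theorem lintegral_frob_le {S : Type*} [MeasurableSpace S] {P : Measure S}
    {M : S → Matrix (Fin v) (Fin v) ℝ} {B : ℝ}
    (hM : ∀ k l, ∃ g : S → ℝ, Integrable g P ∧ (∀ y, |M y k l| ≤ g y) ∧ ∫ y, g y ∂P ≤ B) :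
    ∫⁻ y, ENNReal.ofReal (frob (M y)) ∂P ≤ v * v * ENNReal.ofReal B := by
  choose g hgi hg hgB using hM
  have h0 : ∀ k l y, 0 ≤ g k l y := fun k l y => (abs_nonneg _).trans (hg k l y)
  have hint : Integrable (fun y => ∑ k, ∑ l, g k l y) P :=
    integrable_finsetSum _ fun k _ => integrable_finsetSum _ fun l _ => hgi k l
  calc ∫⁻ y, ENNReal.ofReal (frob (M y)) ∂P
      ≤ ∫⁻ y, ENNReal.ofReal (∑ k, ∑ l, g k l y) ∂P :=
        lintegral_mono fun y => ENNReal.ofReal_le_ofReal ((frob_le_sum_abs _).trans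
          (Finset.sum_le_sum fun k _ => Finset.sum_le_sum fun l _ => hg k l y))
    _ = ENNReal.ofReal (∫ y, ∑ k, ∑ l, g k l y ∂P) :=
        (ofReal_integral_eq_lintegral_ofReal hint (ae_of_all _ fun y =>
          Finset.sum_nonneg fun k _ => Finset.sum_nonneg fun l _ => h0 k l y)).symm
    _ ≤ ENNReal.ofReal (v * v * B) := by
        refine ENNReal.ofReal_le_ofReal ?_
        rw [integral_finsetSum _ fun k _ => integrable_finsetSum _ fun l _ => hgi k l]
        calc _ ≤ ∑ _k : Fin v, ∑ _l : Fin v, B := by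
              refine Finset.sum_le_sum fun k _ => ?_
              rw [integral_finsetSum _ fun l _ => hgi k l]
              exact Finset.sum_le_sum fun l _ => hgB k l
          _ = _ := by simp [mul_assoc]
    _ = _ := by
        rw [ENNReal.ofReal_mul (by positivity), ENNReal.ofReal_mul (by positivity),
          ENNReal.ofReal_natCast]

end FrobeniusNorm

/-! ### Expected error of both estimators under a frozen law. -/

section EstimationError

open ProbabilityTheory

variable {n v : ℕ} {P : Measure (Fin n → EuclideanSpace ℝ (Fin v))}
  {G : SimpleGraph (Fin n)} {θ : ℕ∞ → ℝ} {p R K b : ℝ} {κ : EReal → ℝ}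

/-- Centered version of `hacForm`. -/
def hacFormErr (P : Measure (Fin n → EuclideanSpace ℝ (Fin v))) (κ : EReal → ℝ) (b : ℝ)
    (G : SimpleGraph (Fin n)) (o o' : Option (Fin v))
    (y : Fin n → EuclideanSpace ℝ (Fin v)) : ℝ :=
  hacForm κ b G o o' y - ∫ z, hacForm κ b G o o' z ∂P

theorem HasTruncCov.memLp_hacFormErr [IsProbabilityMeasure P] (h : HasTruncCov P G θ p R K)
    (hp : 4 < p) (o o' : Option (Fin v)) : MemLp (hacFormErr P κ b G o o') 2 P :=
  (h.memLp_hacForm hp o o').sub (memLp_const _)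

theorem HasTruncCov.sqrt_integral_hacFormErr_sq_le [IsProbabilityMeasure P]
    (h : HasTruncCov P G θ p R K) (hp : 4 < p) (hK : 0 ≤ K) (hκ : IsKernel κ) (hb : 0 < b)
    (o o' : Option (Fin v)) :
    √(∫ y, hacFormErr P κ b G o o' y ^ 2 ∂P) ≤ √(4 * covConst R K * bandStat G b p θ) := by
  refine Real.sqrt_le_sqrt ?_
  have := h.cov_hacForm_le hp hK hκ hb o o'
  rwa [covariance_self_eq_integral] at this

theorem integral_abs_le_sqrt {S : Type*} [MeasurableSpace S] {P : Measure S}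
    [IsProbabilityMeasure P] {X : S → ℝ} (hX : MemLp X 2 P) :
    ∫ y, |X y| ∂P ≤ √(∫ y, X y ^ 2 ∂P) := by
  simpa using integral_abs_mul_abs_le_sqrt hX (memLp_const (1 : ℝ))

theorem HasTruncCov.cov_coord_eq [IsProbabilityMeasure P] (h : HasTruncCov P G θ p R K)
    (hp : 4 < p) {Λ : EuclideanSpace ℝ (Fin v)} (hΛ : ∀ i k, ∫ y, y i k ∂P = Λ k)
    (k l : Fin v) (i j : Fin n) :
    ∫ y, nodeProd (some k) (some l) i j y ∂P =
      cov[fun y => coordOrOne (some k) (y i), fun y => coordOrOne (some l) (y j); P]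
        + Λ k * Λ l := by
  rw [covariance_eq_sub (h.memLp_coordOrOne hp _ _) (h.memLp_coordOrOne hp _ _)]
  have hi := hΛ i k
  have hj := hΛ j l
  simp only [coordOrOne, Option.elim_some, hi, hj, Pi.mul_apply]
  simp [nodeProd, coordOrOne]

/-- The centered bias. -/
def hacBias (P : Measure (Fin n → EuclideanSpace ℝ (Fin v))) (κ : EReal → ℝ) (b : ℝ)
    (G : SimpleGraph (Fin n)) (k l : Fin v) : ℝ :=
  (n : ℝ)⁻¹ * (∑ i, ∑ j, weight κ b (G.edist i j) *
    cov[fun y => coordOrOne (some k) (y i), fun y => coordOrOne (some l) (y j); P])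
    - longRunCov P (some k) (some l)

/-- Average kernel weight. -/
def weightSum (κ : EReal → ℝ) (b : ℝ) (G : SimpleGraph (Fin n)) : ℝ :=
  (n : ℝ)⁻¹ * ∑ i, ∑ j, weight κ b (G.edist i j)

theorem abs_weightSum_le (hκ : IsKernel κ) (hb : 0 < b) :
    |weightSum κ b G| ≤ nbhdDensity G b := by
  have hn : (0 : ℝ) ≤ (n : ℝ)⁻¹ := by positivity
  rw [weightSum, nbhdDensity_eq, abs_mul, abs_of_nonneg hn]
  refine mul_le_mul_of_nonneg_left ?_ hn
  refine (Finset.abs_sum_le_sum_abs _ _).trans (Finset.sum_le_sum fun i _ => ?_)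
  exact (Finset.abs_sum_le_sum_abs _ _).trans
    (Finset.sum_le_sum fun j _ => hκ.abs_weight_le G hb i j)

/-- The mean of a product is its covariance plus `Λ k * Λ l`, so a common mean enters only through
the average weight. -/
theorem HasTruncCov.hacForm_some_some [IsProbabilityMeasure P] (h : HasTruncCov P G θ p R K)
    (hp : 4 < p) {Λ : EuclideanSpace ℝ (Fin v)} (hΛ : ∀ i k, ∫ y, y i k ∂P = Λ k)
    (k l : Fin v) (y : Fin n → EuclideanSpace ℝ (Fin v)) :
    hacForm κ b G (some k) (some l) y = hacFormErr P κ b G (some k) (some l) y +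
      hacBias P κ b G k l + longRunCov P (some k) (some l) + Λ k * Λ l * weightSum κ b G := by
  have e : ∫ z, hacForm κ b G (some k) (some l) z ∂P = (n : ℝ)⁻¹ * (∑ i, ∑ j,
      weight κ b (G.edist i j) *
        cov[fun y => coordOrOne (some k) (y i), fun y => coordOrOne (some l) (y j); P])
      + Λ k * Λ l * weightSum κ b G := by
    rw [h.integral_hacForm hp]
    simp only [h.cov_coord_eq hp hΛ, mul_add, Finset.sum_add_distrib, weightSum, ← Finset.sum_mul]
    ring
  rw [hacFormErr, hacBias, e]
  ring

theorem HasTruncCov.hacForm_none_some [IsProbabilityMeasure P] (h : HasTruncCov P G θ p R K)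
    (hp : 4 < p) {Λ : EuclideanSpace ℝ (Fin v)} (hΛ : ∀ i k, ∫ y, y i k ∂P = Λ k)
    (l : Fin v) (y : Fin n → EuclideanSpace ℝ (Fin v)) :
    hacForm κ b G none (some l) y
      = hacFormErr P κ b G none (some l) y + Λ l * weightSum κ b G := by
  have e : ∫ z, hacForm κ b G none (some l) z ∂P = Λ l * weightSum κ b G := by
    rw [h.integral_hacForm hp]
    simp only [nodeProd, coordOrOne, Option.elim_none, Option.elim_some, one_mul, hΛ, weightSum,
      ← Finset.sum_mul]
    ring
  rw [hacFormErr, e]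
  ring

theorem HasTruncCov.hacForm_some_none [IsProbabilityMeasure P] (h : HasTruncCov P G θ p R K)
    (hp : 4 < p) {Λ : EuclideanSpace ℝ (Fin v)} (hΛ : ∀ i k, ∫ y, y i k ∂P = Λ k)
    (k : Fin v) (y : Fin n → EuclideanSpace ℝ (Fin v)) :
    hacForm κ b G (some k) none y
      = hacFormErr P κ b G (some k) none y + Λ k * weightSum κ b G := by
  have e : ∫ z, hacForm κ b G (some k) none z ∂P = Λ k * weightSum κ b G := by
    rw [h.integral_hacForm hp]
    simp only [nodeProd, coordOrOne, Option.elim_none, Option.elim_some, mul_one, hΛ, weightSum,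
      ← Finset.sum_mul]
    ring
  rw [hacFormErr, e]
  ring

/-- Bound on the expected estimation error of an entry. -/
def errBound (C R τ η : ℝ) : ℝ :=
  (1 + 2 * (1 + 4 * R) + 2 * √C) * √(4 * C * τ) + C * η + C * (τ + η)

theorem HasTruncCov.exists_bound_hacZeroMean [IsProbabilityMeasure P]
    (h : HasTruncCov P G θ p R K) (hp : 4 < p) (hK : 0 ≤ K) (hR : 0 ≤ R) (hκ : IsKernel κ)
    (hb : 0 < b) (h0 : ∀ i k, ∫ y, y i k ∂P = 0) (k l : Fin v) :
    ∃ g : (Fin n → EuclideanSpace ℝ (Fin v)) → ℝ, Integrable g P ∧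
      (∀ y, |hacZeroMean κ b G y k l - longRunCov P (some k) (some l)| ≤ g y) ∧
      ∫ y, g y ∂P ≤ errBound (covConst R K) R (bandStat G b p θ) (biasStat κ G b p θ) := by
  have hC := covConst_nonneg (R := R) hK
  have hτ := h.bandStat_nonneg (b := b)
  have hη := h.biasStat_nonneg (κ := κ) (b := b)
  have hX := h.memLp_hacFormErr (κ := κ) (b := b) hp (some k) (some l)
  have hXi := (hX.integrable one_le_two).abs
  refine ⟨fun y => |hacFormErr P κ b G (some k) (some l) y| + |hacBias P κ b G k l|,
    hXi.add (integrable_const _), fun y => ?_, ?_⟩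
  · have e := h.hacForm_some_some (κ := κ) (b := b) hp (Λ := 0) (by simpa using h0) k l y
    have e2 : hacZeroMean κ b G y k l = hacForm κ b G (some k) (some l) y := by
      rw [hacZeroMean_apply]; rfl
    rw [e2, e]
    refine le_trans (le_of_eq ?_) (abs_add_le _ _)
    congr 1
    simp
  · rw [integral_add hXi (integrable_const _)]
    have h1 := (integral_abs_le_sqrt hX).trans
      (h.sqrt_integral_hacFormErr_sq_le hp hK hκ hb (some k) (some l))
    have h2 : |hacBias P κ b G k l| ≤ covConst R K * biasStat κ G b p θ :=
      h.abs_bias_le hp hK hκ (some k) (some l)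
    -- The parts of `errBound` that serve the demeaned estimator are nonnegative and are simply
    -- added.
    have h3 : 0 ≤ covConst R K * (bandStat G b p θ + biasStat κ G b p θ) := by positivity
    have h4 : 0 ≤ (2 * (1 + 4 * R) + 2 * √(covConst R K)) *
      √(4 * covConst R K * bandStat G b p θ) := by positivity
    simp only [integral_const, probReal_univ, smul_eq_mul, one_mul]
    rw [errBound]
    linarith

theorem hacDemeaned_apply (y : Fin n → EuclideanSpace ℝ (Fin v)) (k l : Fin v) :
    hacDemeaned κ b G y k l = hacForm κ b G (some k) (some l) y
      - sampleMean y k * hacForm κ b G none (some l) y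
      - sampleMean y l * hacForm κ b G (some k) none y
      + sampleMean y k * sampleMean y l * weightSum κ b G := by
  rw [hacDemeaned, hacZeroMean_apply]
  simp only [hacForm, weightSum, nodeProd, coordOrOne, Option.elim_none, Option.elim_some,
    Finset.mul_sum, ← Finset.sum_sub_distrib, ← Finset.sum_add_distrib]
  refine Finset.sum_congr rfl fun i _ => Finset.sum_congr rfl fun j _ => ?_
  simp only [PiLp.sub_apply]
  ring

theorem sampleMean_apply (hn : 0 < n) (Λ : EuclideanSpace ℝ (Fin v))
    (y : Fin n → EuclideanSpace ℝ (Fin v)) (k : Fin v) :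
    sampleMean y k = Λ k + centeredMean Λ k y := by
  have hn' : (n : ℝ) ≠ 0 := by exact_mod_cast hn.ne'
  rw [centeredMean, Finset.sum_sub_distrib, mul_sub]
  simp [sampleMean, hn']

/-- Each remaining term contains a centered form, of size √τ in mean square, or is the bias, or is
the average weight times a product of two centered means. -/
theorem HasTruncCov.exists_bound_hacDemeaned [IsProbabilityMeasure P]
    (h : HasTruncCov P G θ p R K) (hp : 4 < p) (hK : 0 ≤ K) (hκ : IsKernel κ)
    (hb : 0 < b) (hn : 0 < n) {Λ : EuclideanSpace ℝ (Fin v)} (hΛ : ∀ i k, ∫ y, y i k ∂P = Λ k)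
    (k l : Fin v) :
    ∃ g : (Fin n → EuclideanSpace ℝ (Fin v)) → ℝ, Integrable g P ∧
      (∀ y, |hacDemeaned κ b G y k l - longRunCov P (some k) (some l)| ≤ g y) ∧
      ∫ y, g y ∂P ≤ errBound (covConst R K) R (bandStat G b p θ) (biasStat κ G b p θ) := by
  have hC := covConst_nonneg (R := R) hK
  have hτ := h.bandStat_nonneg (b := b)
  have hη := h.biasStat_nonneg (κ := κ) (b := b)
  set C := covConst R K
  set τ := bandStat G b p θ
  set η := biasStat κ G b p θ
  set δ := nbhdDensity G b
  set A := fun k => centeredMean (n := n) Λ k with hA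
  set X := fun o o' => hacFormErr P κ b G o o' with hXdef
  have hX : ∀ o o', MemLp (X o o') 2 P := fun o o' => h.memLp_hacFormErr hp o o'
  have hA2 : ∀ k, MemLp (A k) 2 P := fun k => h.memLp_centeredMean hp Λ k
  -- The common mean is the mean at any node, here node 0, hence controlled by the moment bound.
  have hΛb : ∀ k, |Λ k| ≤ 1 + 4 * R := fun k => by
    rw [← hΛ ⟨0, hn⟩ k]
    exact h.abs_integral_coordOrOne_le hp (some k) _
  have hδ0 : 0 ≤ δ := nbhdDensity_nonneg G b
  have hXi : ∀ o o', Integrable (fun y => |X o o' y|) P :=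
    fun o o' => ((hX o o').integrable one_le_two).abs
  have hprod : ∀ {F H : (Fin n → EuclideanSpace ℝ (Fin v)) → ℝ}, MemLp F 2 P → MemLp H 2 P →
      Integrable (fun y => |F y| * |H y|) P := fun hF hH => hF.abs.integrable_mul hH.abs
  have hσ : ∀ o o', √(∫ y, X o o' y ^ 2 ∂P) ≤ √(4 * C * τ) :=
    fun o o' => h.sqrt_integral_hacFormErr_sq_le hp hK hκ hb o o'
  have hX1 : ∀ o o', ∫ y, |X o o' y| ∂P ≤ √(4 * C * τ) :=
    fun o o' => (integral_abs_le_sqrt (hX o o')).trans (hσ o o')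
  have hAsq : ∀ k, ∫ y, A k y ^ 2 ∂P = (n : ℝ)⁻¹ * longRunCov P (some k) (some k) :=
    fun k => h.integral_centeredMean_sq hp hΛ k
  have hA_C : ∀ k, √(∫ y, A k y ^ 2 ∂P) ≤ √C := fun k => by
    rw [hAsq]; exact Real.sqrt_le_sqrt (h.longRunCov_le_card hp hK _ _)
  have hAX : ∀ k o o', ∫ y, |A k y| * |X o o' y| ∂P ≤ √C * √(4 * C * τ) := fun k o o' =>
    (integral_abs_mul_abs_le_sqrt (hA2 k) (hX o o')).trans
      (mul_le_mul (hA_C k) (hσ o o') (Real.sqrt_nonneg _) (Real.sqrt_nonneg _))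
  have hn0 : (0 : ℝ) < n := by exact_mod_cast hn
  have hA_δ : ∀ k, √(∫ y, A k y ^ 2 ∂P) ≤ √((n : ℝ)⁻¹ * (C * (δ + η))) := fun k => by
    rw [hAsq]
    refine Real.sqrt_le_sqrt (mul_le_mul_of_nonneg_left ?_ (by positivity))
    exact h.longRunCov_le hp hK hκ hb _ _
  -- Two factors δ appear, one from the average weight and one from the long-run variance; δ²/n ≤ τ
  -- and δ/n ≤ 1 absorb them.
  have hAA : δ * ∫ y, |A k y| * |A l y| ∂P ≤ C * (τ + η) := by
    have h1 : ∫ y, |A k y| * |A l y| ∂P ≤ (n : ℝ)⁻¹ * (C * (δ + η)) := by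
      refine (integral_abs_mul_abs_le_sqrt (hA2 k) (hA2 l)).trans ?_
      refine (mul_le_mul (hA_δ k) (hA_δ l) (Real.sqrt_nonneg _) (Real.sqrt_nonneg _)).trans ?_
      rw [Real.mul_self_sqrt (by positivity)]
    have h2 : (n : ℝ)⁻¹ * δ ^ 2 ≤ τ := h.nbhdDensity_sq_div_le
    have h3 : (n : ℝ)⁻¹ * δ ≤ 1 := by
      rw [inv_mul_le_iff₀ hn0, mul_one]
      exact nbhdDensity_le G b
    calc δ * ∫ y, |A k y| * |A l y| ∂P ≤ δ * ((n : ℝ)⁻¹ * (C * (δ + η))) := by gcongr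
      _ = C * ((n : ℝ)⁻¹ * δ ^ 2 + (n : ℝ)⁻¹ * δ * η) := by ring
      _ ≤ C * (τ + 1 * η) := by gcongr
      _ = _ := by ring
  have hbias : |hacBias P κ b G k l| ≤ C * η := h.abs_bias_le hp hK hκ (some k) (some l)
  have i1 := hXi (some k) (some l)
  have i2 := (hXi none (some l)).const_mul (1 + 4 * R)
  have i3 := (hXi (some k) none).const_mul (1 + 4 * R)
  have i4 := hprod (hA2 k) (hX none (some l))
  have i5 := hprod (hA2 l) (hX (some k) none)
  have i6 := (hprod (hA2 k) (hA2 l)).const_mul δ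
  have j1 : Integrable (fun y => |X (some k) (some l) y| + C * η) P := i1.add (integrable_const _)
  have j2 : Integrable (fun y => |X (some k) (some l) y| + C * η
    + (1 + 4 * R) * |X none (some l) y|) P := j1.add i2
  have j3 : Integrable (fun y => |X (some k) (some l) y| + C * η
    + (1 + 4 * R) * |X none (some l) y| + (1 + 4 * R) * |X (some k) none y|) P := j2.add i3
  have j4 : Integrable (fun y => |X (some k) (some l) y| + C * η
    + (1 + 4 * R) * |X none (some l) y| + (1 + 4 * R) * |X (some k) none y|
    + |A k y| * |X none (some l) y|) P := j3.add i4
  have j5 : Integrable (fun y => |X (some k) (some l) y| + C * η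
    + (1 + 4 * R) * |X none (some l) y| + (1 + 4 * R) * |X (some k) none y|
    + |A k y| * |X none (some l) y| + |A l y| * |X (some k) none y|) P := j4.add i5
  refine ⟨fun y => |X (some k) (some l) y| + C * η
    + (1 + 4 * R) * |X none (some l) y| + (1 + 4 * R) * |X (some k) none y|
    + |A k y| * |X none (some l) y| + |A l y| * |X (some k) none y|
    + δ * (|A k y| * |A l y|), j5.add i6, fun y => ?_, ?_⟩
  -- Substituting `Λ + A` for the sample mean, the coefficients of `Λ k * Λ l * weightSum` add up to
  -- `1 - 1 - 1 + 1 = 0`, and the mixed terms `Λ * A * weightSum` cancel in pairs.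
  · have e : hacDemeaned κ b G y k l - longRunCov P (some k) (some l)
        = X (some k) (some l) y + hacBias P κ b G k l - Λ k * X none (some l) y
          - Λ l * X (some k) none y - A k y * X none (some l) y - A l y * X (some k) none y
          + weightSum κ b G * (A k y * A l y) := by
      rw [hacDemeaned_apply, h.hacForm_some_some hp hΛ, h.hacForm_none_some hp hΛ,
        h.hacForm_some_none hp hΛ, sampleMean_apply hn Λ, sampleMean_apply hn Λ]
      simp only [hXdef, hA]
      ring
    have a1 : |Λ k * X none (some l) y| ≤ (1 + 4 * R) * |X none (some l) y| := by
      rw [abs_mul]; exact mul_le_mul_of_nonneg_right (hΛb k) (abs_nonneg _)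
    have a2 : |Λ l * X (some k) none y| ≤ (1 + 4 * R) * |X (some k) none y| := by
      rw [abs_mul]; exact mul_le_mul_of_nonneg_right (hΛb l) (abs_nonneg _)
    have a3 : |weightSum κ b G * (A k y * A l y)| ≤ δ * (|A k y| * |A l y|) := by
      rw [abs_mul, abs_mul (A k y)]
      exact mul_le_mul_of_nonneg_right (abs_weightSum_le hκ hb) (by positivity)
    rw [e]
    beta_reduce
    rw [← abs_mul (A k y) (X none (some l) y), ← abs_mul (A l y) (X (some k) none y)]
    refine (abs_add_le _ _).trans (add_le_add ?_ a3)
    refine (abs_sub _ _).trans (add_le_add ?_ le_rfl)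
    refine (abs_sub _ _).trans (add_le_add ?_ le_rfl)
    refine (abs_sub _ _).trans (add_le_add ?_ a2)
    refine (abs_sub _ _).trans (add_le_add ?_ a1)
    exact (abs_add_le _ _).trans (add_le_add le_rfl hbias)
  · rw [integral_add j5 i6, integral_add j4 i5, integral_add j3 i4, integral_add j2 i3,
      integral_add j1 i2, integral_add i1 (integrable_const _)]
    have hR : 0 ≤ 1 + 4 * R := (abs_nonneg _).trans (hΛb k)
    have k2 := mul_le_mul_of_nonneg_left (hX1 none (some l)) hR
    have k3 := mul_le_mul_of_nonneg_left (hX1 (some k) none) hR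
    have k1 := hX1 (some k) (some l)
    have k4 := hAX k none (some l)
    have k5 := hAX l (some k) none
    simp only [integral_const, integral_const_mul, probReal_univ, smul_eq_mul, one_mul]
    rw [errBound]
    linarith

theorem tendsto_errBound {C R : ℝ} {τ η : ℕ → ℝ} (hτ : Tendsto τ atTop (𝓝 0))
    (hη : Tendsto η atTop (𝓝 0)) :
    Tendsto (fun n => errBound C R (τ n) (η n)) atTop (𝓝 0) := by
  unfold errBound
  have h1 : Tendsto (fun n => √(4 * C * τ n)) atTop (𝓝 0) := by
    have := (hτ.const_mul (4 * C)).sqrt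
    simpa using this
  have := ((h1.const_mul (1 + 2 * (1 + 4 * R) + 2 * √C)).add (hη.const_mul C)).add
    ((hτ.add hη).const_mul C)
  simpa using this

end EstimationError

/-! ### Clamped coordinates as bounded Lipschitz test functions. -/

section TestFunctions

variable {v a n : ℕ}

theorem supNorm_nonneg (f : (Fin a → EuclideanSpace ℝ (Fin v)) → ℝ) : 0 ≤ supNorm f :=
  Real.iSup_nonneg fun _ => abs_nonneg _

theorem lipConst_nonneg (f : (Fin a → EuclideanSpace ℝ (Fin v)) → ℝ) : 0 ≤ lipConst f :=
  Real.sInf_nonneg fun _ hL => hL.1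

theorem mem_BLip_and_norm_le {f : (Fin a → EuclideanSpace ℝ (Fin v)) → ℝ} {B L : ℝ}
    (hB : ∀ x, |f x| ≤ B) (hL : LipBound f L) :
    f ∈ BLip v a ∧ supNorm f + lipConst f ≤ B + L :=
  ⟨⟨⟨B, hB⟩, ⟨L, hL⟩⟩, add_le_add (ciSup_le hB) (csInf_le ⟨0, fun _ h => h.1⟩ hL)⟩

theorem norm_sub_le_sum (x y : Fin a → EuclideanSpace ℝ (Fin v)) (q : Fin a) :
    ‖x q - y q‖ ≤ ∑ l, ‖x l - y l‖ :=
  Finset.single_le_sum (f := fun l => ‖x l - y l‖) (fun _ _ => norm_nonneg _) (Finset.mem_univ q)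

theorem abs_clamp_coordOrOne_sub_le (c : ℕ) (o : Option (Fin v))
    (x y : Fin a → EuclideanSpace ℝ (Fin v)) (q : Fin a) :
    |clamp c (coordOrOne o (x q)) - clamp c (coordOrOne o (y q))| ≤ ∑ l, ‖x l - y l‖ :=
  (abs_clamp_sub_le _ _ _).trans ((abs_coordOrOne_sub_le _ _ _).trans (norm_sub_le_sum x y q))

theorem exists_BLip_clamp {c : ℕ} (hc : 1 ≤ c) (o : Option (Fin v)) (i : Fin n) :
    ∃ f : BLip v 1, (∀ y : Fin n → EuclideanSpace ℝ (Fin v),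
      f.1 (subTuple y {i} (Finset.card_singleton i)) = clamp c (coordOrOne o (y i))) ∧
      supNorm f.1 + lipConst f.1 ≤ 2 * c := by
  have hc' : (1 : ℝ) ≤ c := by exact_mod_cast hc
  have h := mem_BLip_and_norm_le (a := 1) (v := v) (B := c) (L := 1)
    (f := fun x => clamp c (coordOrOne o (x 0))) (fun x => abs_clamp_le _ _)
    ⟨zero_le_one, fun x y => by rw [one_mul]; exact abs_clamp_coordOrOne_sub_le c o x y 0⟩
  refine ⟨⟨_, h.1⟩, fun y => ?_, h.2.trans (by linarith)⟩
  simp [subTuple]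

/-- The product has sup-norm at most `c ^ 2` and, by the product rule, Lipschitz constant at most `2
* c`. The set `A` is arbitrary so that `i = j` is allowed. -/
theorem exists_BLip_truncNodeProd {c : ℕ} (hc : 1 ≤ c) (o o' : Option (Fin v)) (i j : Fin n)
    {A : Finset (Fin n)} (hA : A.card = a) (hi : i ∈ A) (hj : j ∈ A) :
    ∃ f : BLip v a, (∀ y : Fin n → EuclideanSpace ℝ (Fin v),
      f.1 (subTuple y A hA) = truncNodeProd c o o' i j y) ∧
      supNorm f.1 + lipConst f.1 ≤ 3 * c ^ 2 := by
  have hc' : (1 : ℝ) ≤ c := by exact_mod_cast hc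
  have hpos : ∀ x ∈ A, ∃ q, A.orderEmbOfFin hA q = x := fun x hx => by
    have : x ∈ Set.range (A.orderEmbOfFin hA) := by rw [Finset.range_orderEmbOfFin]; exact hx
    exact this
  obtain ⟨q, hq⟩ := hpos i hi
  obtain ⟨q', hq'⟩ := hpos j hj
  have h := mem_BLip_and_norm_le (a := a) (v := v) (B := c ^ 2) (L := 2 * c)
    (f := fun x => clamp c (coordOrOne o (x q)) * clamp c (coordOrOne o' (x q')))
    (fun x => by
      rw [abs_mul, sq]
      exact mul_le_mul (abs_clamp_le _ _) (abs_clamp_le _ _) (abs_nonneg _) (by positivity))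
    ⟨by positivity, fun x y => by
      have e : clamp c (coordOrOne o (x q)) * clamp c (coordOrOne o' (x q'))
          - clamp c (coordOrOne o (y q)) * clamp c (coordOrOne o' (y q'))
          = clamp c (coordOrOne o (x q)) *
              (clamp c (coordOrOne o' (x q')) - clamp c (coordOrOne o' (y q')))
            + (clamp c (coordOrOne o (x q)) - clamp c (coordOrOne o (y q))) *
              clamp c (coordOrOne o' (y q')) := by ring
      rw [e]
      refine (abs_add_le _ _).trans ?_
      rw [abs_mul, abs_mul]
      have h1 : |clamp c (coordOrOne o (x q))| *
          |clamp c (coordOrOne o' (x q')) - clamp c (coordOrOne o' (y q'))|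
          ≤ c * ∑ l, ‖x l - y l‖ :=
        mul_le_mul (abs_clamp_le _ _) (abs_clamp_coordOrOne_sub_le c o' x y q') (abs_nonneg _)
          (by positivity)
      have h2 : |clamp c (coordOrOne o (x q)) - clamp c (coordOrOne o (y q))| *
          |clamp c (coordOrOne o' (y q'))| ≤ (∑ l, ‖x l - y l‖) * c :=
        mul_le_mul (abs_clamp_coordOrOne_sub_le c o x y q) (abs_clamp_le _ _) (abs_nonneg _)
          (Finset.sum_nonneg fun _ _ => norm_nonneg _)
      linarith⟩
  refine ⟨⟨_, h.1⟩, fun y => ?_, h.2.trans (by nlinarith)⟩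
  simp [subTuple, hq, hq', truncNodeProd]

end TestFunctions

/-! ### Joint measurability of the estimation error. -/

section Measurability

variable {Ω : Type*} [m : MeasurableSpace Ω] {n v : ℕ}

theorem measurable_weight_edist {κ : EReal → ℝ} (hκ : IsKernel κ) {b : Ω → ℝ} (hb : Measurable b)
    {G : Ω → SimpleGraph (Fin n)} (hG : ∀ i j, MeasurableSet {ω | (G ω).Adj i j}) (i j : Fin n) :
    Measurable fun ω => weight κ (b ω) ((G ω).edist i j) := by
  -- There are finitely many graphs on `Fin n`, so with the discrete σ-field joint measurability can
  -- be checked one graph at a time.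
  let _ : MeasurableSpace (SimpleGraph (Fin n)) := ⊤
  have hGm : Measurable G := by
    refine measurable_to_countable' fun H => ?_
    have e : G ⁻¹' {H} = ⋂ i, ⋂ j, {ω | (G ω).Adj i j ↔ H.Adj i j} := by
      ext ω
      simp only [Set.mem_preimage, Set.mem_singleton_iff, Set.mem_iInter, Set.mem_ofPred_eq]
      refine ⟨fun h i j => by rw [h], fun h => ?_⟩
      ext i j
      exact h i j
    rw [e]
    refine MeasurableSet.iInter fun i => MeasurableSet.iInter fun j => ?_
    by_cases hH : H.Adj i j
    · simpa [hH] using hG i j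
    · simp only [hH, iff_false]
      exact (hG i j).compl
  have h2 : Measurable fun q : ℝ × SimpleGraph (Fin n) => weight κ q.1 (q.2.edist i j) :=
    measurable_from_prod_countable_left fun H => hκ.measurable_weight (H.edist i j)
  exact h2.comp (hb.prodMk hGm)

theorem measurable_frob_hacZeroMean_sub {κ : EReal → ℝ} (hκ : IsKernel κ) {b : Ω → ℝ}
    (hb : Measurable b) {G : Ω → SimpleGraph (Fin n)}
    (hG : ∀ i j, MeasurableSet {ω | (G ω).Adj i j})
    {V : Ω → Matrix (Fin v) (Fin v) ℝ} (hV : ∀ k l, Measurable fun ω => V ω k l)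
    {Φ : (Fin n → EuclideanSpace ℝ (Fin v)) → Fin n → EuclideanSpace ℝ (Fin v)}
    (hΦ : Measurable Φ) :
    Measurable fun q : Ω × (Fin n → EuclideanSpace ℝ (Fin v)) =>
      ENNReal.ofReal (frob (hacZeroMean κ (b q.1) (G q.1) (Φ q.2) - V q.1)) := by
  have hc : ∀ i (k : Fin v), Measurable fun y => Φ y i k := fun i k =>
    (continuous_coordOrOne (some k)).measurable.comp
      ((measurable_pi_apply i).comp hΦ)
  simp only [frob_eq, Matrix.sub_apply, hacZeroMean_apply]
  refine (Measurable.sqrt ?_).ennreal_ofReal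
  refine Finset.measurable_fun_sum _ fun k _ => Finset.measurable_fun_sum _ fun l _ => ?_
  refine Measurable.pow_const (Measurable.sub (Measurable.const_mul ?_ _)
    ((hV k l).comp measurable_fst)) 2
  refine Finset.measurable_fun_sum _ fun i _ => Finset.measurable_fun_sum _ fun j _ => ?_
  exact ((measurable_weight_edist hκ hb hG i j).comp measurable_fst).mul
    (((hc i k).comp measurable_snd).mul ((hc j l).comp measurable_snd))

end Measurability

/-! ### Transfer of the assumptions to the conditional law. -/

section ConditionalLaw

open ProbabilityTheory

variable {Ω : Type*} {m mΩ : MeasurableSpace Ω} {μ : Measure Ω} {n v : ℕ}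
  {Y : Fin n → Ω → EuclideanSpace ℝ (Fin v)}
  {ν : Ω → Measure (Fin n → EuclideanSpace ℝ (Fin v))} {p K : ℝ}

/-- The bound `M` is quantified after the null set because it will be the random supremum of the
conditional norms. -/
theorem IsCondLaw.moment_le (hν : IsCondLaw m μ (fun ω i => Y i ω) ν) (hp : 0 < p) (i : Fin n) :
    ∀ᵐ ω ∂μ, ∀ M : ℝ≥0∞, M < ⊤ → condNorm m μ p (Y i) ω ≤ M →
      Integrable (fun y => ‖y i‖ ^ p) (ν ω) ∧ ∫ y, ‖y i‖ ^ p ∂(ν ω) ≤ (M ^ p).toReal := by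
  have hmeas : Measurable fun y : Fin n → EuclideanSpace ℝ (Fin v) => ‖y i‖ₑ ^ p :=
    (measurable_pi_apply i).enorm.pow_const p
  filter_upwards [hν.condLExp_ae_eq (fun q => ‖q.2 i‖ₑ ^ p)
    (hmeas.comp (@measurable_snd Ω _ m _))] with ω h M hM hle
  have h1 : ∫⁻ y, ‖y i‖ₑ ^ p ∂(ν ω) ≤ M ^ p := by
    rw [condNorm, h, one_div, ENNReal.rpow_inv_le_iff hp] at hle
    exact hle
  have hMp : M ^ p ≠ ⊤ := ENNReal.rpow_ne_top_of_nonneg hp.le hM.ne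
  have e : ∀ y : Fin n → EuclideanSpace ℝ (Fin v), ENNReal.ofReal (‖y i‖ ^ p) = ‖y i‖ₑ ^ p :=
    fun y => by
      rw [← ENNReal.ofReal_rpow_of_nonneg (norm_nonneg _) hp.le, ofReal_norm]
  have hsm : AEStronglyMeasurable (fun y : Fin n → EuclideanSpace ℝ (Fin v) => ‖y i‖ ^ p) (ν ω) :=
    ((measurable_pi_apply i).norm.pow_const p).aestronglyMeasurable
  have h0 : 0 ≤ᵐ[ν ω] fun y => ‖y i‖ ^ p := ae_of_all _ fun y => by positivity
  refine ⟨⟨hsm, ?_⟩, ?_⟩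
  · rw [hasFiniteIntegral_iff_ofReal h0]
    simp only [e]
    exact h1.trans_lt hMp.lt_top
  · rw [integral_eq_lintegral_of_nonneg_ae h0 hsm]
    simp only [e]
    exact ENNReal.toReal_mono hMp h1

/-- `HasTruncCov` serves only to supply square integrability at `ω`; the null set depends on none of
its parameters. -/
theorem IsCondLaw.longRunVar_eq (hν : IsCondLaw m μ (fun ω i => Y i ω) ν) (hp : 4 < p) :
    ∀ᵐ ω ∂μ, ∀ (G : SimpleGraph (Fin n)) (θ : ℕ∞ → ℝ) (R K : ℝ), HasTruncCov (ν ω) G θ p R K →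
      ∀ k l, longRunVar m μ Y ω k l = longRunCov (ν ω) (some k) (some l) := by
  have hsum : ∀ k : Fin v, ∀ y : Fin n → EuclideanSpace ℝ (Fin v),
      ((√(n : ℝ))⁻¹ • ∑ i, y i) k = (√(n : ℝ))⁻¹ * ∑ i, coordOrOne (some k) (y i) := by
    intro k y
    simp [coordOrOne]
  have hmeas : ∀ k : Fin v, Measurable fun y : Fin n → EuclideanSpace ℝ (Fin v) =>
      (√(n : ℝ))⁻¹ * ∑ i, coordOrOne (some k) (y i) := fun k =>
    (Finset.measurable_fun_sum _ fun i _ =>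
      (continuous_coordOrOne_eval (some k) i).measurable).const_mul _
  have h := ae_all_iff.2 fun k : Fin v => ae_all_iff.2 fun l : Fin v =>
    hν.condCov_eq (hmeas k) (hmeas l)
  filter_upwards [h] with ω h G θ R K hT k l
  have := hν.isProbabilityMeasure ω
  have hm := fun (k : Fin v) (i : Fin n) => hT.memLp_coordOrOne hp (some k) i
  have hS : ∀ k : Fin v, MemLp (fun y : Fin n → EuclideanSpace ℝ (Fin v) =>
      ∑ i, coordOrOne (some k) (y i)) 2 (ν ω) := fun k => memLp_finsetSum _ fun i _ => hm k i
  have e := h k l ((hS k).const_mul _) ((hS l).const_mul _)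
  rw [longRunVar, Matrix.of_apply]
  simp only [← hsum] at e
  rw [e]
  simp only [hsum]
  rw [covariance_const_mul_left, covariance_const_mul_right,
    covariance_fun_sum_fun_sum (hm k) (hm l), longRunCov, ← mul_assoc, ← mul_inv,
    Real.mul_self_sqrt (Nat.cast_nonneg n)]

theorem IsCondLaw.integral_eq_condE (hν : IsCondLaw m μ (fun ω i => Y i ω) ν) (i : Fin n)
    (k : Fin v) :
    ∀ᵐ ω ∂μ, Integrable (fun y => y i k) (ν ω) →
      condE m μ (fun ω' => Y i ω' k) ω = ∫ y, y i k ∂(ν ω) :=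
  hν.condE_eq (F := fun q => q.2 i k)
    ((continuous_coordOrOne_eval (some k) i).measurable.comp (@measurable_snd Ω _ m _))

theorem IsCondLaw.condCov_eq_of_bounded (hν : IsCondLaw m μ (fun ω i => Y i ω) ν)
    {f g : (Fin n → EuclideanSpace ℝ (Fin v)) → ℝ} (hf : Measurable f) (hg : Measurable g)
    {B : ℝ} (hfB : ∀ y, |f y| ≤ B) (hgB : ∀ y, |g y| ≤ B) :
    ∀ᵐ ω ∂μ, condCov m μ (fun ω => f fun i => Y i ω) (fun ω => g fun i => Y i ω) ω
      = cov[f, g; ν ω] := by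
  filter_upwards [hν.condCov_eq hf hg] with ω h
  have := hν.isProbabilityMeasure ω
  exact h (MemLp.of_bound hf.aestronglyMeasurable B (ae_of_all _ hfB))
    (MemLp.of_bound hg.aestronglyMeasurable B (ae_of_all _ hgB))

/-- Truncation levels, coordinates, nodes and distances range over countable sets, so one null set
serves all the covariance inequalities. -/
theorem IsCondLaw.ae_hasTruncCov (hν : IsCondLaw m μ (fun ω i => Y i ω) ν) (hp : 4 < p)
    {G : Ω → SimpleGraph (Fin n)} {θ : ℕ∞ → Ω → ℝ} (hθ : ∀ s ω, 0 ≤ θ s ω)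
    (hθ0 : ∀ ω, θ 0 ω = 1) {ψ : (a b : ℕ) → BLip v a → BLip v b → ℝ}
    (hcov : ∀ a b : ℕ, 1 ≤ a → 1 ≤ b → ∀ s : ℕ∞, 0 < s →
      ∀ (A B : Finset (Fin n)) (hA : A.card = a) (hB : B.card = b) (f : BLip v a) (g : BLip v b),
      ∀ᵐ ω ∂μ, s ≤ setDist (G ω) A B →
        |condCov m μ (fun ω' => f.1 (subTuple (fun i => Y i ω') A hA))
          (fun ω' => g.1 (subTuple (fun i => Y i ω') B hB)) ω| ≤ ψ a b f g * θ s ω)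
    (hK : 0 ≤ K)
    (hψ : ∀ a b : ℕ, 1 ≤ a → 1 ≤ b → ∀ (f : BLip v a) (g : BLip v b), ψ a b f g
      ≤ K * (a * b) * (supNorm f.1 + lipConst f.1) * (supNorm g.1 + lipConst g.1)) :
    ∀ᵐ ω ∂μ, ∀ M : ℝ≥0∞, M < ⊤ → (∀ i, condNorm m μ p (Y i) ω ≤ M) →
      HasTruncCov (ν ω) (G ω) (fun s => θ s ω) p (M ^ p).toReal (36 * K) := by
  classical
  have hcov' : ∀ (a b : ℕ) (A B : Finset (Fin n)) (hA : A.card = a) (hB : B.card = b),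
      1 ≤ a → 1 ≤ b → ∀ (f : BLip v a) (g : BLip v b) (D N : ℝ), 0 ≤ D →
      supNorm f.1 + lipConst f.1 ≤ D → supNorm g.1 + lipConst g.1 ≤ D →
      K * (a * b) * D * D ≤ N → ∀ᵐ ω ∂μ, ∀ s : ℕ∞, 0 < s → s ≤ setDist (G ω) A B →
        |condCov m μ (fun ω' => f.1 (subTuple (fun i => Y i ω') A hA))
          (fun ω' => g.1 (subTuple (fun i => Y i ω') B hB)) ω| ≤ N * θ s ω := by
    intro a b A B hA hB ha hb f g D N hD hf hg hN
    -- The distance at which the bound is used is random; making it hold for every `s` in the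
    -- countable `ℕ∞` allows `s` to be chosen after `ω`.
    refine ae_all_iff.2 fun s => ae_all_iff.2 fun hs => ?_
    filter_upwards [hcov a b ha hb s hs A B hA hB f g] with ω h hle
    refine (h hle).trans (mul_le_mul_of_nonneg_right ?_ (hθ s ω))
    refine (hψ _ _ ha hb f g).trans (le_trans ?_ hN)
    have hg0 : 0 ≤ supNorm g.1 + lipConst g.1 := add_nonneg (supNorm_nonneg _) (lipConst_nonneg _)
    exact mul_le_mul (mul_le_mul_of_nonneg_left hf (by positivity)) hg hg0 (by positivity)
  have hsingle : ∀ᵐ ω ∂μ, ∀ (c : ℕ) (_ : 1 ≤ c) (o o' : Option (Fin v)) (i j : Fin n),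
      0 < (G ω).edist i j →
      |cov[fun y => clamp c (coordOrOne o (y i)), fun y => clamp c (coordOrOne o' (y j)); ν ω]|
        ≤ 36 * K * c ^ (1 + 1) * θ ((G ω).edist i j) ω := by
    refine ae_all_iff.2 fun c => ae_all_iff.2 fun hc => ae_all_iff.2 fun o => ae_all_iff.2 fun o' =>
      ae_all_iff.2 fun i => ae_all_iff.2 fun j => ?_
    obtain ⟨f, hf, hfD⟩ := exists_BLip_clamp hc o i
    obtain ⟨g, hg, hgD⟩ := exists_BLip_clamp hc o' j
    have h1 := hcov' 1 1 {i} {j} (Finset.card_singleton i) (Finset.card_singleton j) le_rfl le_rfl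
      f g (2 * c) (36 * K * c ^ (1 + 1)) (by positivity) hfD hgD (by
        have h0 : 0 ≤ K * (c : ℝ) ^ 2 := by positivity
        calc K * (((1 : ℕ) : ℝ) * ((1 : ℕ) : ℝ)) * (2 * c) * (2 * c) = 4 * (K * (c : ℝ) ^ 2) := by
              push_cast; ring
          _ ≤ 36 * (K * (c : ℝ) ^ 2) := by linarith
          _ = _ := by ring)
    have h2 := hν.condCov_eq_of_bounded
      ((continuous_clamp c).comp (continuous_coordOrOne_eval o i)).measurable
      ((continuous_clamp c).comp (continuous_coordOrOne_eval o' j)).measurable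
      (fun y => abs_clamp_le c _) (fun y => abs_clamp_le c _)
    filter_upwards [h1, h2] with ω h1 h2 hpos
    have h3 := h1 _ hpos (by
      refine le_iInf₂ fun x hx => le_iInf₂ fun y hy => ?_
      rw [Finset.mem_singleton.1 hx, Finset.mem_singleton.1 hy])
    simp only [hf, hg] at h3
    have h2' : _ = cov[fun y => clamp c (coordOrOne o (y i)),
      fun y => clamp c (coordOrOne o' (y j)); ν ω] := h2
    rw [← h2']
    exact h3
  have hpair : ∀ᵐ ω ∂μ, ∀ (c : ℕ) (_ : 1 ≤ c) (o₁ o₂ o₃ o₄ : Option (Fin v)) (i j i' j' : Fin n),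
      0 < pairDist (G ω) i j i' j' →
      |cov[truncNodeProd c o₁ o₂ i j, truncNodeProd c o₃ o₄ i' j'; ν ω]|
        ≤ 36 * K * c ^ (2 + 2) * θ (pairDist (G ω) i j i' j') ω := by
    refine ae_all_iff.2 fun c => ae_all_iff.2 fun hc => ae_all_iff.2 fun o₁ => ae_all_iff.2 fun o₂ =>
      ae_all_iff.2 fun o₃ => ae_all_iff.2 fun o₄ => ae_all_iff.2 fun i => ae_all_iff.2 fun j =>
      ae_all_iff.2 fun i' => ae_all_iff.2 fun j' => ?_
    obtain ⟨f, hf, hfD⟩ := exists_BLip_truncNodeProd (A := {i, j}) hc o₁ o₂ i j rfl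
      (by simp) (by simp)
    obtain ⟨g, hg, hgD⟩ := exists_BLip_truncNodeProd (A := {i', j'}) hc o₃ o₄ i' j' rfl
      (by simp) (by simp)
    have hb : ∀ (o o' : Option (Fin v)) (i j : Fin n) (y : Fin n → EuclideanSpace ℝ (Fin v)),
        |truncNodeProd c o o' i j y| ≤ c * c := fun o o' i j y => by
      rw [truncNodeProd, abs_mul]
      exact mul_le_mul (abs_clamp_le _ _) (abs_clamp_le _ _) (abs_nonneg _) (by positivity)
    -- At most two nodes on each side and norms at most `3 * c ^ 2` give `2 * 2 * 3 * 3 = 36`.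
    have h1 := hcov' _ _ {i, j} {i', j'} rfl rfl (Finset.card_pos.2 (by simp))
      (Finset.card_pos.2 (by simp)) f g (3 * c ^ 2) (36 * K * c ^ (2 + 2)) (by positivity)
      hfD hgD (by
        have n1 : (({i, j} : Finset (Fin n)).card : ℝ) ≤ 2 := by exact_mod_cast Finset.card_le_two
        have n2 : (({i', j'} : Finset (Fin n)).card : ℝ) ≤ 2 := by
          exact_mod_cast Finset.card_le_two
        calc _ ≤ K * (2 * 2) * (3 * (c : ℝ) ^ 2) * (3 * (c : ℝ) ^ 2) := by gcongr
          _ = _ := by ring)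
    have h2 := hν.condCov_eq_of_bounded (measurable_truncNodeProd c o₁ o₂ i j)
      (measurable_truncNodeProd c o₃ o₄ i' j') (hb o₁ o₂ i j) (hb o₃ o₄ i' j')
    filter_upwards [h1, h2] with ω h1 h2 hpos
    have h3 := h1 _ hpos (pairDist_le_setDist (G ω) i j i' j')
    simp only [hf, hg] at h3
    rw [← h2]
    exact h3
  filter_upwards [hsingle, hpair, ae_all_iff.2 fun i => hν.moment_le (p := p) (by linarith) i]
    with ω h1 h2 h3 M hM hMle
  exact ⟨fun i => (h3 i M hM (hMle i)).1, fun i => (h3 i M hM (hMle i)).2, fun s => hθ s ω, hθ0 ω,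
    h1, h2⟩

end ConditionalLaw

end

end NetworkHAC

/-! ### Assembly of the proposition. -/

open NetworkHAC in
theorem proposition4p1 {Ω : Type*} [mΩ : MeasurableSpace Ω] (μ : Measure Ω) [IsProbabilityMeasure μ]
    (v : ℕ)
    -- the σ-fields, the networks, and the triangular array
    (C : ℕ → MeasurableSpace Ω) (hC : ∀ n, C n ≤ mΩ)
    (G : (n : ℕ) → Ω → SimpleGraph (Fin n))
    (hG : ∀ n (i j : Fin n), MeasurableSet[C n] {ω | (G n ω).Adj i j})
    (Y : (n : ℕ) → Fin n → Ω → EuclideanSpace ℝ (Fin v)) (hY : ∀ n i, Measurable (Y n i))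
    -- the kernel and the bandwidth
    (κ : EReal → ℝ) (hκ : IsKernel κ)
    (b : ℕ → Ω → ℝ) (hb : ∀ n, Measurable[C n] (b n)) (hb_pos : ∀ᵐ ω ∂μ, ∀ᶠ n in atTop, 0 < b n ω)
    -- conditional ψ-dependence
    (θ : ℕ → ℕ∞ → Ω → ℝ) (ψ : ℕ → (a b : ℕ) → BLip v a → BLip v b → ℝ)
    (hψ : IsPsiDependent μ C G Y θ ψ)
    (hψ_bound : ∃ K : ℝ, 0 < K ∧ ∀ (n a b : ℕ), 1 ≤ a → 1 ≤ b → ∀ (f : BLip v a) (g : BLip v b),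
      ψ n a b f g ≤ K * (a * b) * (supNorm f.1 + lipConst f.1) * (supNorm g.1 + lipConst g.1))
    (hθ_bound : ∀ᵐ ω ∂μ, ∃ K : ℝ, ∀ (n : ℕ) (s : ℕ∞), 1 ≤ s → θ n s ω ≤ K)
    -- moments, kernel weights, and bandwidth
    (p : ℝ) (hp : 4 < p)
    (h_moment : ∀ᵐ ω ∂μ, (⨆ n : ℕ, ⨆ i : Fin n, condNorm (C n) μ p (Y n i) ω) < ⊤)
    (h_weight : ∀ᵐ ω ∂μ, Tendsto (fun n : ℕ => ∑' s : ℕ∞, if 1 ≤ s then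
      |weight κ (b n ω) s - 1| * shellDensity (G n ω) s 1 * θ n s ω ^ (1 - 2 / p) else 0)
      atTop (𝓝 0))
    (h_band : ∀ᵐ ω ∂μ, Tendsto (fun n : ℕ => (n : ℝ)⁻¹ * ∑' s : ℕ∞,
      cStat (G n ω) s (b n ω) 2 * θ n s ω ^ (1 - 4 / p)) atTop (𝓝 0)) :
    -- known zero mean
    ((∀ n i k, condE (C n) μ (fun ω => Y n i ω k) =ᵐ[μ] 0) →
      ∀ᵐ ω ∂μ, Tendsto (fun n : ℕ => condLExp (C n) μ (fun ω' => ENNReal.ofReal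
        (frob (hacZeroMean κ (b n ω') (G n ω') (fun i => Y n i ω') - longRunVar (C n) μ (Y n) ω')))
        ω) atTop (𝓝 0)) ∧
    -- unknown common mean
    (∀ Λ : ℕ → Ω → EuclideanSpace ℝ (Fin v),
      (∀ n i k, condE (C n) μ (fun ω => Y n i ω k) =ᵐ[μ] fun ω => Λ n ω k) →
      (∀ᵐ ω ∂μ, (fun n : ℕ => nbhdDensity (G n ω) (b n ω)) =o[atTop] (fun n : ℕ => (n : ℝ))) →
      (∀ᵐ ω ∂μ, ∀ (n s t : ℕ), 1 ≤ s → s ≤ t →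
        θ n t ω / (t : ℝ) ^ (p / (p - 4)) ≤ θ n s ω / (s : ℝ) ^ (p / (p - 4))) →
      ∀ᵐ ω ∂μ, Tendsto (fun n : ℕ => condLExp (C n) μ (fun ω' => ENNReal.ofReal
        (frob (hacDemeaned κ (b n ω') (G n ω') (fun i => Y n i ω') - longRunVar (C n) μ (Y n) ω')))
        ω) atTop (𝓝 0)) := by
  obtain ⟨K, hK0, hK⟩ := hψ_bound
  have hν_ex : ∀ n, ∃ ν : Ω → Measure (Fin n → EuclideanSpace ℝ (Fin v)),
      IsCondLaw (C n) μ (fun ω i => Y n i ω) ν := fun n =>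
    exists_isCondLaw (C n) (hC n) μ (measurable_pi_lambda _ fun i => hY n i)
  choose ν hν using hν_ex
  have hT := ae_all_iff.2 fun n => (hν n).ae_hasTruncCov hp (fun s ω => hψ.coeff_nonneg n s ω)
    (hψ.coeff_zero n) (hψ.cov_le n) hK0.le (hK n)
  have hV := ae_all_iff.2 fun n => (hν n).longRunVar_eq hp
  have hE := ae_all_iff.2 fun n => ae_all_iff.2 fun i => ae_all_iff.2 fun k =>
    (hν n).integral_eq_condE i k
  have hVm : ∀ n k l, Measurable[C n] fun ω => longRunVar (C n) μ (Y n) ω k l :=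
    fun n k l => measurable_condE (C n) μ _
  have hlim : ∀ (τ η : ℕ → ℝ) (R C : ℝ), Tendsto τ atTop (𝓝 0) → Tendsto η atTop (𝓝 0) →
      Tendsto (fun n => (v : ℝ≥0∞) * v * ENNReal.ofReal (errBound C R (τ n) (η n))) atTop
        (𝓝 0) := by
    intro τ η R C hτ hη
    have h1 := ENNReal.tendsto_ofReal (tendsto_errBound (C := C) (R := R) hτ hη)
    have h2 := ENNReal.Tendsto.const_mul (a := (v : ℝ≥0∞) * v) h1
      (Or.inr (ENNReal.mul_ne_top (ENNReal.natCast_ne_top v) (ENNReal.natCast_ne_top v)))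
    simpa using h2
  constructor
  · intro h_mean
    -- The error is a jointly measurable function of `(ω, Y)`, `ω` entering through `C n` only, so
    -- its conditional expectation is an integral under `ν n ω`.
    have hF := ae_all_iff.2 fun n => (hν n).condLExp_ae_eq _
      (measurable_frob_hacZeroMean_sub (m := C n) hκ (hb n) (hG n) (hVm n) measurable_id)
    have hM := ae_all_iff.2 fun n => ae_all_iff.2 fun i => ae_all_iff.2 fun k => h_mean n i k
    filter_upwards [hT, hV, hE, hF, hM, hb_pos, h_moment, h_weight, h_band]
      with ω hT hV hE hF hM hbp hmom hw hbd
    have hTn := fun n => hT n _ hmom fun i =>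
      le_iSup_of_le n (le_iSup (fun i => condNorm (C n) μ p (Y n i) ω) i)
    -- At fixed `ω` this moment bound is uniform in `n`, so the constants in the error bound do not
    -- change along the sequence.
    set R := ((⨆ n : ℕ, ⨆ i : Fin n, condNorm (C n) μ p (Y n i) ω) ^ p).toReal
    refine tendsto_of_tendsto_of_tendsto_of_le_of_le' tendsto_const_nhds
      (hlim _ _ R (covConst R (36 * K)) hbd hw) (Eventually.of_forall fun _ => zero_le) ?_
    filter_upwards [hbp] with n hbn
    have := (hν n).isProbabilityMeasure ω
    have hcoord := fun i k => ((hTn n).memLp_coordOrOne hp (some k) i).integrable one_le_two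
    have hmean : ∀ i k, ∫ y, y i k ∂(ν n ω) = 0 := fun i k => by
      rw [← hE n i k (hcoord i k), hM n i k]; rfl
    refine (le_of_eq (hF n)).trans (lintegral_frob_le fun k l => ?_)
    simp only [Matrix.sub_apply, hV n _ _ _ _ (hTn n)]
    exact (hTn n).exists_bound_hacZeroMean hp (by positivity) ENNReal.toReal_nonneg hκ hbn hmean k l
  · intro Λ h_mean _ _
    have hcenter : ∀ n, Measurable fun (y : Fin n → EuclideanSpace ℝ (Fin v)) i =>
        y i - sampleMean y := fun n => by
      unfold sampleMean
      exact Continuous.measurable (by fun_prop)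
    have hF := ae_all_iff.2 fun n => (hν n).condLExp_ae_eq _
      (measurable_frob_hacZeroMean_sub (m := C n) hκ (hb n) (hG n) (hVm n) (hcenter n))
    have hM := ae_all_iff.2 fun n => ae_all_iff.2 fun i => ae_all_iff.2 fun k => h_mean n i k
    filter_upwards [hT, hV, hE, hF, hM, hb_pos, h_moment, h_weight, h_band]
      with ω hT hV hE hF hM hbp hmom hw hbd
    have hTn := fun n => hT n _ hmom fun i =>
      le_iSup_of_le n (le_iSup (fun i => condNorm (C n) μ p (Y n i) ω) i)
    set R := ((⨆ n : ℕ, ⨆ i : Fin n, condNorm (C n) μ p (Y n i) ω) ^ p).toReal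
    refine tendsto_of_tendsto_of_tendsto_of_le_of_le' tendsto_const_nhds
      (hlim _ _ R (covConst R (36 * K)) hbd hw) (Eventually.of_forall fun _ => zero_le) ?_
    -- A nonempty sample is needed for `sampleMean` to split as `Λ` plus the centered mean, and to
    -- bound `Λ` by a moment at a node.
    filter_upwards [hbp, eventually_gt_atTop 0] with n hbn hn
    have := (hν n).isProbabilityMeasure ω
    have hcoord := fun i k => ((hTn n).memLp_coordOrOne hp (some k) i).integrable one_le_two
    have hmean : ∀ i k, ∫ y, y i k ∂(ν n ω) = Λ n ω k := fun i k => by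
      rw [← hE n i k (hcoord i k), hM n i k]
    refine (le_of_eq (hF n)).trans (lintegral_frob_le fun k l => ?_)
    simp only [Matrix.sub_apply, hV n _ _ _ _ (hTn n)]
    exact (hTn n).exists_bound_hacDemeaned hp (by positivity) hκ hbn hn hmean k l
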